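/- Let $\mathbb{T}=\mathbb{R}\cup\{-\infty\}$ be the tropical semiring (addition is maximum, multiplication is $+$). For $A\in M_{r\times c}(\mathbb{T})$, let $C(A)\subseteq\mathbb{T}^r$ and $R(A)\subseteq\mathbb{T}^c$ be the $\mathbb{T}$-subsemimodules generated by the columns and by the rows of $A$; $A$ has full rank if the minimum cardinality of a generating set is $c$ for $C(A)$ and $r$ for $R(A)$. Let $H_A$ be the $\mathcal{H}$-class of $A$ in the category of all matrices over $\mathbb{T}$ (the matrices generating the same principal left ideal and the same principal right ideal as $A$), and let $G_A$ be the group of all units $P$ of the monoid $M_r(\mathbb{T})$ with $PX\in H_A$ for all $X\in H_A$. A square matrix $P$ has eigenvalue $\lambda$ if $P\otimes x=\lambda\otimes x$ for some vector $x$ not identically $-\infty$. Let $A\in M_{r\times c}(\mathbb{T})$ have full rank. Let $\mathcal{B}_A$ be the bipartite graph with vertices $\omega_1,\dots,\omega_r$ and $\theta_1,\dots,\theta_c$, with an edge between $\omega_s$ and $\theta_t$ if and only if $A_{s,t}\neq-\infty$; let $\mathcal{C}_A$ be its set of connected components and, for $X\in\mathcal{C}_A$, let $A|_X$ be the submatrix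 of $A$ on the rows $s$ with $\omega_s\in X$ and the columns $t$ with $\theta_t\in X$. Let $\mathcal{C}_A=\bigcup_{i=1}^k\mathcal{C}_i$ be the partition into nonempty classes such that $X,Y$ lie in the same class if and only if $C(A|_X)\cong C(A|_Y)$ as $\mathbb{T}$-semimodules, and write $\mathcal{C}_i=\{C_{i,1},\dots,C_{i,n_i}\}$ with $n_i=|\mathcal{C}_i|$. For $1\le i\le k$ put \[ G_i=\{P\in G_{A|_{C_{i,1}}} : P \text{ has the eigenvalue } 0\}. \] Then each $G_i$ is a subgroup of $G_{A|_{C_{i,1}}}$, is finite, and embeds in the symmetric group $\mathcal{S}_{r_i}$, where $r_i$ is the number of rows of $A|_{C_{i,1}}$; and \[ G_A\cong\prod_{i=1}^k\bigl((\mathbb{R}\times G_i)\wr\mathcal{S}_{n_i}\bigr), \] where $\mathbb{R}$ is the additive group of reals and $N\wr\mathcal{S}_{n}$ denotes the semidirect product $N^{n}\rtimes\mathcal{S}_n$ with $\mathcal{S}_n$ permuting the coordinates. -/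

import Mathlib

/-- The tropical semiring `ℝ ∪ {-∞}` with maximum as addition and addition as multiplication:
Mathlib's min-plus tropicalization applied to the reversed order on `ℝ`, so that the adjoined top
element `⊤` of the reversed order is `-∞`. It is a commutative semiring, whose `0` is `-∞` and whose
`1` is the real number `0`. -/
abbrev MaxPlus : Type := Tropical (WithTop ℝᵒᵈ)

namespace MaxPlus

/-- The real number `x` as an element of the tropical semiring. -/
def ofReal (x : ℝ) : MaxPlus := Tropical.trop ((OrderDual.toDual x : ℝᵒᵈ) : WithTop ℝᵒᵈ)

theorem ofReal_add_ofReal (x y : ℝ) : ofReal x + ofReal y = ofReal (max x y) := by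
  rcases le_total x y with h | h
  · rw [max_eq_right h]
    exact Tropical.add_eq_right (WithTop.coe_le_coe.2 (OrderDual.toDual_le_toDual.2 h))
  · rw [max_eq_left h]
    exact Tropical.add_eq_left (WithTop.coe_le_coe.2 (OrderDual.toDual_le_toDual.2 h))

theorem ofReal_mul_ofReal (x y : ℝ) : ofReal x * ofReal y = ofReal (x + y) := rfl

theorem ofReal_zero : ofReal 0 = 1 := rfl

/-- Every tropical number is `-∞` or a real number, and not both. -/
theorem ne_zero_iff (a : MaxPlus) : a ≠ 0 ↔ ∃ x : ℝ, a = ofReal x := by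
  constructor
  · intro h
    have h' : Tropical.untrop a ≠ (⊤ : WithTop ℝᵒᵈ) := fun e => h (congrArg Tropical.trop e)
    obtain ⟨x, hx⟩ := WithTop.ne_top_iff_exists.1 h'
    exact ⟨OrderDual.ofDual x, congrArg Tropical.trop hx.symm⟩
  · rintro ⟨x, rfl⟩ h
    exact WithTop.coe_ne_top (congrArg Tropical.untrop h)

end MaxPlus

namespace TropicalMatrix

section General

variable {m n : Type} [Fintype m] [Fintype n]

/-- The column space: the subsemimodule of `𝕋^m` generated by the columns. -/
noncomputable def colSpace (A : Matrix m n MaxPlus) : Submodule MaxPlus (m → MaxPlus) :=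
  Submodule.span MaxPlus (Set.range A.col)

/-- The row space: the subsemimodule of `𝕋^n` generated by the rows. -/
noncomputable def rowSpace (A : Matrix m n MaxPlus) : Submodule MaxPlus (n → MaxPlus) :=
  Submodule.span MaxPlus (Set.range A.row)

/-- The column rank: the minimum cardinality of a generating set of the column space. -/
noncomputable def colRank (A : Matrix m n MaxPlus) : ℕ := (colSpace A).spanFinrank

/-- The row rank: the minimum cardinality of a generating set of the row space. -/
noncomputable def rowRank (A : Matrix m n MaxPlus) : ℕ := (rowSpace A).spanFinrank

/-- Full rank: full row rank and full column rank. -/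
def FullRank (A : Matrix m n MaxPlus) : Prop :=
  rowRank A = Fintype.card m ∧ colRank A = Fintype.card n

/-- The principal right ideal `A S` generated by `A` in the category `S` of tropical matrices. -/
def rightIdeal (A : Matrix m n MaxPlus) : Set (Σ k : ℕ, Matrix m (Fin k) MaxPlus) :=
  {Y | ∃ X : Matrix n (Fin Y.1) MaxPlus, Y.2 = A * X}

/-- The principal left ideal `S A` generated by `A` in the category `S` of tropical matrices. -/
def leftIdeal (A : Matrix m n MaxPlus) : Set (Σ k : ℕ, Matrix (Fin k) n MaxPlus) :=
  {Y | ∃ X : Matrix (Fin Y.1) m MaxPlus, Y.2 = X * A}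

/-- The `H`-class of `A`: the matrices that generate the same principal right ideal and the same
principal left ideal as `A` (these have the same size as `A`, since equal principal one-sided ideals
of a category have a common codomain, respectively domain). -/
def hClass (A : Matrix m n MaxPlus) : Set (Matrix m n MaxPlus) :=
  {B | rightIdeal B = rightIdeal A ∧ leftIdeal B = leftIdeal A}

theorem leftIdeal_unit_mul {m n : Type} [Fintype m] [DecidableEq m] (P : (Matrix m m MaxPlus)ˣ) (A : Matrix m n MaxPlus) :
    leftIdeal ((P : Matrix m m MaxPlus) * A) = leftIdeal A := by
  ext ⟨k, Y⟩
  constructor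
  · rintro ⟨X, hX⟩
    exact ⟨X * (P : Matrix m m MaxPlus), by rw [Matrix.mul_assoc]; exact hX⟩
  · rintro ⟨X, hX⟩
    refine ⟨X * (↑P⁻¹ : Matrix m m MaxPlus), ?_⟩
    rw [Matrix.mul_assoc, ← Matrix.mul_assoc _ (P : Matrix m m MaxPlus) A, Units.inv_mul,
      Matrix.one_mul]
    exact hX

theorem rightIdeal_mul_congr (P : Matrix m m MaxPlus) {A B : Matrix m n MaxPlus}
    (h : rightIdeal A = rightIdeal B) : rightIdeal (P * A) = rightIdeal (P * B) := by
  have key : ∀ {A B : Matrix m n MaxPlus}, rightIdeal A = rightIdeal B →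
      rightIdeal (P * A) ⊆ rightIdeal (P * B) := by
    rintro A B h ⟨k, Y⟩ ⟨X, hX⟩
    obtain ⟨Z, hZ⟩ : (⟨k, A * X⟩ : Σ k : ℕ, Matrix m (Fin k) MaxPlus) ∈ rightIdeal B :=
      h ▸ ⟨X, rfl⟩
    refine ⟨Z, ?_⟩
    have hX' : Y = P * A * X := hX
    have hZ' : A * X = B * Z := hZ
    change Y = P * B * Z
    rw [hX', Matrix.mul_assoc, hZ', Matrix.mul_assoc]
  exact Set.Subset.antisymm (key h) (key h.symm)

/-- The group `G_A` of all units `P` of the monoid of square matrices such that `P X ∈ H_A` for all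
`X ∈ H_A`, where `H_A` is the `H`-class of `A`. -/
def unitGroup [DecidableEq m] (A : Matrix m n MaxPlus) : Subgroup (Matrix m m MaxPlus)ˣ where
  carrier := {P | ∀ X ∈ hClass A, (P : Matrix m m MaxPlus) * X ∈ hClass A}
  one_mem' := fun X hX => by simpa using hX
  mul_mem' := fun {P Q} hP hQ X hX => by
    rw [Units.val_mul, Matrix.mul_assoc]
    exact hP _ (hQ X hX)
  inv_mem' := fun {P} hP X hX => by
    refine ⟨?_, (leftIdeal_unit_mul P⁻¹ X).trans hX.2⟩
    have h1 : rightIdeal X = rightIdeal ((P : Matrix m m MaxPlus) * X) :=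
      hX.1.trans (hP X hX).1.symm
    have h2 := rightIdeal_mul_congr (↑P⁻¹ : Matrix m m MaxPlus) h1
    rw [← Matrix.mul_assoc, Units.inv_mul, Matrix.one_mul] at h2
    exact h2.trans hX.1

/-- `a` is an eigenvalue of the square matrix `P`: `P ⊗ x = a ⊗ x` for some vector `x` that is not
constantly `-∞`. -/
def HasEigenvalue (P : Matrix m m MaxPlus) (a : MaxPlus) : Prop :=
  ∃ x : m → MaxPlus, x ≠ 0 ∧ P.mulVec x = a • x

/-- The set of elements of `G_A` that have the real number `0` as an eigenvalue. -/
def zeroEigenSet [DecidableEq m] (A : Matrix m n MaxPlus) : Set (Matrix m m MaxPlus)ˣ :=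
  {P | P ∈ unitGroup A ∧ HasEigenvalue (P : Matrix m m MaxPlus) (MaxPlus.ofReal 0)}

end General

section Components

variable {r c : ℕ}

/-- The (uncoloured, undirected) bipartite graph underlying `𝓑_A`: row vertices `Sum.inl i`,
column vertices `Sum.inr j`, and an edge between them exactly when `A i j ≠ -∞`. Colours and
directions do not matter for connected components. -/
def bipartiteGraph (A : Matrix (Fin r) (Fin c) MaxPlus) : SimpleGraph (Fin r ⊕ Fin c) :=
  SimpleGraph.fromRel fun u v => ∃ i j, u = Sum.inl i ∧ v = Sum.inr j ∧ A i j ≠ 0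

/-- The set `𝓒_A` of connected components. -/
abbrev Component (A : Matrix (Fin r) (Fin c) MaxPlus) : Type :=
  (bipartiteGraph A).ConnectedComponent

/-- The rows of `A` that belong to the component `X`. -/
abbrev RowsOf (A : Matrix (Fin r) (Fin c) MaxPlus) (X : Component A) : Type :=
  {i : Fin r // (bipartiteGraph A).connectedComponentMk (Sum.inl i) = X}

/-- The columns of `A` that belong to the component `X`. -/
abbrev ColsOf (A : Matrix (Fin r) (Fin c) MaxPlus) (X : Component A) : Type :=
  {j : Fin c // (bipartiteGraph A).connectedComponentMk (Sum.inr j) = X}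

noncomputable instance (A : Matrix (Fin r) (Fin c) MaxPlus) (X : Component A) :
    Fintype (RowsOf A X) := Fintype.ofFinite _

noncomputable instance (A : Matrix (Fin r) (Fin c) MaxPlus) (X : Component A) :
    Fintype (ColsOf A X) := Fintype.ofFinite _

/-- The submatrix `A|_X` on the rows and columns of the component `X`. -/
def restrict (A : Matrix (Fin r) (Fin c) MaxPlus) (X : Component A) :
    Matrix (RowsOf A X) (ColsOf A X) MaxPlus :=
  A.submatrix Subtype.val Subtype.val

end Components

/-- The wreath product `N ≀ 𝓢_k` of a group with the symmetric group on `k` points: the semidirect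
product of `N ^ k` with `𝓢_k` acting by permuting the coordinates. -/
abbrev SymmWreath (N : Type) [Group N] (k : ℕ) : Type :=
  (Fin k → N) ⋊[mulAutArrow (G := Equiv.Perm (Fin k)) (A := Fin k) (M := N)] Equiv.Perm (Fin k)

end TropicalMatrix

set_option linter.unusedSectionVars false

/-! ### Arithmetic and order of tropical numbers -/

namespace MaxPlus

/-! The engine is rigidity: an irredundant generating family of a tropical column space is unique up
to order and scaling (`ColIrredundant.exists_equiv`). Compared with the identity matrix, it shows
that invertible matrices are monomial. Compared for `A` and `P * A`, it shows that `G_A` consists of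
the units `P` with `P A = A Q` for some unit `Q`. With a duality argument for the rows, it shows
that column spaces of full rank matrices are isomorphic exactly when `B = U A V` with `U`, `V`
invertible, and such an equivalence conjugates the groups.

Hence `A` may be replaced by a block diagonal matrix repeating one representative of each class of
components. If `P A = A Q`, the permutations underlying `P` and `Q` carry finite entries to finite
entries, so by connectedness they move whole blocks to whole blocks. The moved blocks are
equivalent, so classes are preserved, and what remains of `P` is a permutation of each class
together with elements of the representatives' groups: a product of wreath products.

For a connected block, some power of each `P` in the group is scalar. The mean of the weights of `P`
is a homomorphism to the reals split by the scalars, which are central; this gives the factor of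
reals. Since a power is scalar, mean zero is the same as having eigenvalue 0, and an element of the
kernel is determined by its permutation. So the kernel is the required finite permutation group. -/

theorem exists_mul_eq_one {a : MaxPlus} (h : a ≠ 0) : ∃ b, a * b = 1 := by
  obtain ⟨x, rfl⟩ := (ne_zero_iff a).1 h
  exact ⟨ofReal (-x), by rw [ofReal_mul_ofReal, add_neg_cancel, ofReal_zero]⟩

theorem isUnit_iff {a : MaxPlus} : IsUnit a ↔ a ≠ 0 :=
  ⟨fun h => h.ne_zero, fun h => (exists_mul_eq_one h).elim fun b hb => IsUnit.of_mul_eq_one b hb⟩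

theorem mul_left_cancel {a b c : MaxPlus} (ha : a ≠ 0) (h : a * b = a * c) : b = c :=
  (isUnit_iff.2 ha).mul_left_cancel h

/-- The multiplicative inverse of a nonzero tropical number; the inverse of `0` is `0`. -/
noncomputable def recip (a : MaxPlus) : MaxPlus :=
  open Classical in if h : a ≠ 0 then (exists_mul_eq_one h).choose else 0

theorem mul_recip {a : MaxPlus} (h : a ≠ 0) : a * recip a = 1 := by
  rw [recip, dif_pos h]
  exact (exists_mul_eq_one h).choose_spec

theorem recip_mul {a : MaxPlus} (h : a ≠ 0) : recip a * a = 1 := by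
  rw [mul_comm, mul_recip h]

theorem recip_ne_zero {a : MaxPlus} (h : a ≠ 0) : recip a ≠ 0 :=
  right_ne_zero_of_mul_eq_one (mul_recip h)

theorem mul_lt_mul_left {a b c : MaxPlus} (ha : a ≠ 0) (h : b < c) : a * b < a * c := by
  refine lt_of_le_of_ne (mul_le_mul_right h.le a) fun e => h.ne (mul_left_cancel ha e)

/-- The order on `MaxPlus` is opposite to that of the reals: `0 = -∞` is the greatest element and a
sum is the least of its terms. Inequalities below are to be read in this reversed sense. -/
theorem lt_zero {a : MaxPlus} (h : a ≠ 0) : a < 0 := lt_of_le_of_ne (Tropical.le_zero a) h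

section Sum

variable {ι : Type*}

theorem sum_le {s : Finset ι} {f : ι → MaxPlus} {i : ι} (hi : i ∈ s) : ∑ j ∈ s, f j ≤ f i := by
  classical
  rw [← Finset.add_sum_erase s f hi]
  rcases le_total (f i) (∑ j ∈ s.erase i, f j) with h | h
  · rw [Tropical.add_eq_left h]
  · rw [Tropical.add_eq_right h]; exact h

theorem exists_eq_sum {s : Finset ι} {f : ι → MaxPlus} (h : ∑ j ∈ s, f j ≠ 0) :
    ∃ i ∈ s, f i = ∑ j ∈ s, f j := by
  classical
  induction s using Finset.induction_on with
  | empty => simp at h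
  | insert a s ha ih =>
    rw [Finset.sum_insert ha] at h ⊢
    rcases le_total (f a) (∑ j ∈ s, f j) with h' | h'
    · exact ⟨a, Finset.mem_insert_self _ _, (Tropical.add_eq_left h').symm⟩
    · rw [Tropical.add_eq_right h'] at h ⊢
      obtain ⟨i, hi, e⟩ := ih h
      exact ⟨i, Finset.mem_insert_of_mem hi, e⟩

theorem le_sum {s : Finset ι} {f : ι → MaxPlus} {a : MaxPlus} (h : ∀ i ∈ s, a ≤ f i) :
    a ≤ ∑ j ∈ s, f j := by
  by_cases h0 : ∑ j ∈ s, f j = 0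
  · rw [h0]; exact Tropical.le_zero a
  · obtain ⟨i, hi, e⟩ := exists_eq_sum h0
    exact e ▸ h i hi

theorem lt_sum {s : Finset ι} {f : ι → MaxPlus} {a : MaxPlus} (ha : a ≠ 0)
    (h : ∀ i ∈ s, a < f i) : a < ∑ j ∈ s, f j := by
  by_cases h0 : ∑ j ∈ s, f j = 0
  · rw [h0]; exact lt_zero ha
  · obtain ⟨i, hi, e⟩ := exists_eq_sum h0
    exact e ▸ h i hi

end Sum

end MaxPlus

namespace TropicalMatrix

open MaxPlus Matrix

/-! ### Uniqueness of irredundant generating families -/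

section Irredundant

variable {m n n' : Type} [Fintype n] [Fintype n']

/-- No column of `A` is a linear combination of the other columns. -/
def ColIrredundant (A : Matrix m n MaxPlus) : Prop :=
  ∀ (j : n) (x : n → MaxPlus), x j = 0 → A.mulVec x ≠ A.col j

theorem ColIrredundant.exists_ne_zero {A : Matrix m n MaxPlus} (hA : ColIrredundant A) (j : n) :
    ∃ i, A i j ≠ 0 := by
  by_contra! h
  exact hA j 0 rfl (funext fun i => by simp [h i])

theorem ColIrredundant.eq_of_proportional {A : Matrix m n MaxPlus} (hA : ColIrredundant A)
    {j k : n} {q : MaxPlus} (h : ∀ i, A i j = A i k * q) : j = k := by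
  classical
  by_contra hne
  refine hA j (Pi.single k q) (by simp [hne]) (funext fun i => ?_)
  simp [h i]

/-- If the real value of `Z j j` is negative or `-∞`, its term never attains a finite entry of
column `j`, so the other columns already generate that column. If it is positive, its term
overshoots a finite entry. -/
theorem ColIrredundant.diag_eq_one {A : Matrix m n MaxPlus} (hA : ColIrredundant A)
    {Z : Matrix n n MaxPlus} (h : A = A * Z) (j : n) : Z j j = 1 := by
  classical
  have h' : ∀ i, A i j = ∑ l, A i l * Z l j := fun i => by
    conv_lhs => rw [h]
    rfl
  refine le_antisymm (le_of_not_gt fun hlt => ?_) (le_of_not_gt fun hlt => ?_)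
  · refine hA j (Function.update (fun l => Z l j) j 0) (by simp) (funext fun i => ?_)
    have h1 := h' i
    rw [← Finset.add_sum_erase _ _ (Finset.mem_univ j)] at h1
    have h2 : A.mulVec (Function.update (fun l => Z l j) j 0) i =
        ∑ l ∈ Finset.univ.erase j, A i l * Z l j := by
      rw [mulVec, dotProduct, ← Finset.add_sum_erase _ _ (Finset.mem_univ j)]
      rw [Function.update_self, mul_zero, zero_add]
      refine Finset.sum_congr rfl fun l hl => ?_
      rw [Function.update_of_ne (Finset.ne_of_mem_erase hl)]
    rw [h2]
    change _ = A i j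
    rcases eq_or_ne (A i j) 0 with h0 | h0
    · rw [h0, zero_mul, zero_add] at h1
      rw [← h1, h0]
    · rcases Tropical.add_eq_iff.1 h1.symm with ⟨h3, -⟩ | ⟨h3, -⟩
      · exact absurd (mul_left_cancel h0 (h3.trans (mul_one _).symm)) hlt.ne'
      · exact h3
  · obtain ⟨i, hi⟩ := hA.exists_ne_zero j
    have h1 : A i j ≤ A i j * Z j j := by
      conv_lhs => rw [h' i]
      exact sum_le (Finset.mem_univ j)
    have h2 := mul_lt_mul_left hi hlt
    rw [mul_one] at h2
    exact absurd h1 h2.not_ge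

/-- The diagonal entry `(Y X) j j = 1` is attained by a single `k`, with `Y j k` and `X k j`
mutually inverse. The domination of column `j` of `A` over `X k j` times column `k` of `B` can then
be reversed using `Y j k`. -/
theorem ColIrredundant.exists_proportional {A : Matrix m n MaxPlus} {B : Matrix m n' MaxPlus}
    (hA : ColIrredundant A) {X : Matrix n' n MaxPlus} {Y : Matrix n n' MaxPlus}
    (hX : A = B * X) (hY : B = A * Y) (j : n) :
    ∃ (k : n') (q : MaxPlus), q ≠ 0 ∧ ∀ i, A i j = B i k * q := by
  have hZ : (Y * X) j j = 1 := hA.diag_eq_one (by rw [← Matrix.mul_assoc, ← hY, hX]) j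
  obtain ⟨k, -, hk⟩ := exists_eq_sum (s := Finset.univ) (f := fun k => Y j k * X k j)
    (by change (Y * X) j j ≠ 0; rw [hZ]; exact one_ne_zero)
  replace hk : Y j k * X k j = 1 := hk.trans hZ
  refine ⟨k, X k j, right_ne_zero_of_mul_eq_one hk, fun i => le_antisymm ?_ ?_⟩
  · conv_lhs => rw [hX]
    exact sum_le (f := fun k => B i k * X k j) (Finset.mem_univ k)
  · have h1 : B i k ≤ A i j * Y j k := by
      conv_lhs => rw [hY]
      exact sum_le (f := fun j => A i j * Y j k) (Finset.mem_univ j)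
    calc B i k * X k j ≤ A i j * Y j k * X k j := mul_le_mul_left h1 _
      _ = A i j := by rw [mul_assoc, hk, mul_one]

/-- Two irredundant generating families of the same column space agree up to order and scaling. -/
theorem ColIrredundant.exists_equiv {A : Matrix m n MaxPlus} {B : Matrix m n' MaxPlus}
    (hA : ColIrredundant A) (hB : ColIrredundant B) {X : Matrix n' n MaxPlus}
    {Y : Matrix n n' MaxPlus} (hX : A = B * X) (hY : B = A * Y) :
    ∃ (τ : n ≃ n') (q : n → MaxPlus), (∀ j, q j ≠ 0) ∧ ∀ i j, A i j = B i (τ j) * q j := by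
  choose τ q hq h using hA.exists_proportional hX hY
  have hτ : Function.Bijective τ := by
    refine ⟨fun j j' e => ?_, fun k => ?_⟩
    · refine hA.eq_of_proportional (q := recip (q j') * q j) fun i => ?_
      rw [h j, h j', e, ← mul_assoc, mul_assoc _ (q j'), mul_recip (hq j'), mul_one]
    · obtain ⟨j, q', -, h'⟩ := hB.exists_proportional hY hX k
      exact ⟨j, (hB.eq_of_proportional (q := q j * q') fun i => by
        rw [h', h j, mul_assoc]).symm⟩
  exact ⟨Equiv.ofBijective τ hτ, q, hq, fun i j => h j i⟩

end Irredundant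

/-! ### Duality between the kernel congruence and the row space -/

section Duality

variable {m n : Type} [Fintype m] [Fintype n]

/-- A linear form whose kernel congruence contains that of `A` is a combination of the rows
of `A`. -/
theorem exists_vecMul_eq {A : Matrix m n MaxPlus} {a : n → MaxPlus} (hrow : ∀ i, ∃ j, A i j ≠ 0)
    (h : ∀ x y, A.mulVec x = A.mulVec y → a ⬝ᵥ x = a ⬝ᵥ y) : ∃ c, c ᵥ* A = a := by
  classical
  -- Residuation: in the real order `l i` minimises `a j - A i j`, and these minima are the largest
  -- coefficients `c` for which `c A` does not exceed `a`.
  have key : ∀ i, ∃ l, A i l ≠ 0 ∧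
      ∀ j, A i j ≠ 0 → a j * recip (A i j) ≤ a l * recip (A i l) := fun i => by
    obtain ⟨j, hj⟩ := hrow i
    obtain ⟨l, hl, hmax⟩ := Finset.exists_max_image
      (Finset.univ.filter fun j => A i j ≠ 0) (fun j => a j * recip (A i j)) ⟨j, by simpa using hj⟩
    exact ⟨l, by simpa using hl, fun j hj => hmax j (by simpa using hj)⟩
  choose l hl hmax using key
  have hge : ∀ i j, a j ≤ a (l i) * recip (A i (l i)) * A i j := fun i j => by
    rcases eq_or_ne (A i j) 0 with h0 | h0
    · rw [h0, mul_zero]; exact Tropical.le_zero _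
    · calc a j = a j * recip (A i j) * A i j := by rw [mul_assoc, recip_mul h0, mul_one]
        _ ≤ _ := mul_le_mul_left (hmax i j h0) _
  refine ⟨fun i => a (l i) * recip (A i (l i)), funext fun j => ?_⟩
  refine le_antisymm (le_of_not_gt fun hlt => ?_) (le_sum fun i _ => hge i j)
  have hlt' : ∀ i, a j < a (l i) * recip (A i (l i)) * A i j := fun i =>
    hlt.trans_le (sum_le (f := fun i => a (l i) * recip (A i (l i)) * A i j) (Finset.mem_univ i))
  have ha : a j ≠ 0 := hlt.ne_top
  -- If `c A` falls short of `a` at `j`, this `w` is a witness against `h`: `A w` already dominates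
  -- column `j`, so adding the basis vector at `j` leaves it unchanged. But `a ⬝ᵥ w` is the value of
  -- `c A` at `j`, which in the real order is strictly below `a j`.
  set w : n → MaxPlus := ∑ i, Pi.single (l i) (recip (A i (l i)) * A i j) with hw
  have hAw : A.mulVec (w + Pi.single j 1) = A.mulVec w := by
    rw [mulVec_add]
    funext i
    refine Tropical.add_eq_left ?_
    rw [hw, mulVec_sum, mulVec_single_one, Finset.sum_apply]
    refine (sum_le (Finset.mem_univ i)).trans (le_of_eq ?_)
    rw [mulVec_single]
    change A i (l i) * (recip (A i (l i)) * A i j) = A i j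
    rw [← mul_assoc, mul_recip (hl i), one_mul]
  have h1 := h _ _ hAw
  rw [dotProduct_add, dotProduct_single, mul_one] at h1
  have h2 : a j < a ⬝ᵥ w := by
    rw [hw, dotProduct_sum]
    refine lt_sum ha fun i _ => ?_
    rw [dotProduct_single, ← mul_assoc]
    exact hlt' i
  rw [Tropical.add_eq_right h2.le] at h1
  exact h2.ne h1

end Duality

/-! ### Full rank implies irredundancy -/

section FullRank

variable {m n : Type} [Fintype m] [Fintype n]

/-- A redundant column could be dropped, leaving a generating set with fewer elements than the rank.
-/
theorem colIrredundant_of_colRank {A : Matrix m n MaxPlus} (h : colRank A = Fintype.card n) :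
    ColIrredundant A := by
  classical
  intro j x hx hAx
  have hle : colSpace A = Submodule.span MaxPlus (A.col '' {j}ᶜ) := by
    refine le_antisymm (Submodule.span_le.2 ?_) (Submodule.span_mono (Set.image_subset_range _ _))
    rintro _ ⟨l, rfl⟩
    rcases eq_or_ne l j with rfl | hl
    · rw [← hAx, mulVec_eq_sum]
      refine Submodule.sum_mem _ fun k _ => ?_
      rcases eq_or_ne k l with rfl | hk
      · rw [hx]; simp
      · rw [op_smul_eq_smul]
        exact Submodule.smul_mem _ _ (Submodule.subset_span ⟨k, hk, rfl⟩)
    · exact Submodule.subset_span ⟨l, hl, rfl⟩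
  have h1 := Submodule.spanFinrank_span_le_ncard_of_finite (R := MaxPlus)
    (s := A.col '' {j}ᶜ) (Set.toFinite _)
  rw [← hle] at h1
  have h2 := Set.ncard_image_le (f := A.col) (s := {j}ᶜ) (Set.toFinite _)
  have h3 : ({j}ᶜ : Set n).ncard < Fintype.card n := by
    rw [← Nat.card_eq_fintype_card]
    exact Set.ncard_lt_card (by simp)
  exact absurd (h1.trans h2) (by rw [← h] at h3; exact h3.not_ge)

theorem FullRank.colIrredundant {A : Matrix m n MaxPlus} (h : FullRank A) : ColIrredundant A :=
  colIrredundant_of_colRank h.2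

theorem FullRank.colIrredundant_transpose {A : Matrix m n MaxPlus} (h : FullRank A) :
    ColIrredundant Aᵀ :=
  colIrredundant_of_colRank h.1

theorem ColIrredundant.mul_left {m' : Type} {A : Matrix m n MaxPlus} (hA : ColIrredundant A)
    [DecidableEq m] {U : Matrix m' m MaxPlus} [Fintype m'] {U' : Matrix m m' MaxPlus}
    (h : U' * U = 1) : ColIrredundant (U * A) := by
  intro j x hx e
  refine hA j x hx ?_
  have h1 := congrArg U'.mulVec e
  have h2 : (U * A).col j = U.mulVec (A.col j) := rfl
  rwa [h2, mulVec_mulVec, mulVec_mulVec, ← Matrix.mul_assoc, h, Matrix.one_mul, one_mulVec] at h1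

theorem colIrredundant_one [DecidableEq n] : ColIrredundant (1 : Matrix n n MaxPlus) := by
  intro j x hx e
  have := congrFun e j
  rw [one_mulVec, hx] at this
  exact zero_ne_one (this.trans (by simp [col]))

end FullRank

/-! ### Monomial matrices and invertibility -/

section Monomial

variable {m n n' : Type} [Fintype n] [Fintype n'] [DecidableEq n] [DecidableEq n']

/-- The matrix with entry `q j` in row `τ j` of column `j` and `-∞` elsewhere. -/
def monomial (τ : n ≃ n') (q : n → MaxPlus) : Matrix n' n MaxPlus :=
  Matrix.of fun i j => if i = τ j then q j else 0

theorem monomial_apply (τ : n ≃ n') (q : n → MaxPlus) (i : n') (j : n) :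
    monomial τ q i j = if i = τ j then q j else 0 := rfl

theorem mul_monomial_apply (A : Matrix m n' MaxPlus) (τ : n ≃ n') (q : n → MaxPlus) (i : m)
    (j : n) : (A * monomial τ q) i j = A i (τ j) * q j := by
  simp [Matrix.mul_apply, monomial_apply]

theorem monomial_mul_apply (A : Matrix n m MaxPlus) (τ : n ≃ n') (q : n → MaxPlus) (i : n)
    (j : m) : (monomial τ q * A) (τ i) j = q i * A i j := by
  simp [Matrix.mul_apply, monomial_apply]

theorem monomial_mul_monomial {n'' : Type} [Fintype n''] [DecidableEq n''] (τ : n ≃ n') (q : n → MaxPlus)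
    (τ' : n' ≃ n'') (q' : n' → MaxPlus) :
    monomial τ' q' * monomial τ q = monomial (τ.trans τ') fun j => q' (τ j) * q j := by
  ext i j
  rw [mul_monomial_apply, monomial_apply, monomial_apply]
  simp only [ite_mul, zero_mul, Equiv.trans_apply]
  rfl

theorem monomial_refl_one : monomial (Equiv.refl n) (fun _ => 1) = 1 := by
  ext i j
  simp only [monomial_apply, Matrix.one_apply, Equiv.refl_apply]
  rfl

/-- The inverse of a monomial matrix. -/
noncomputable def monomialInv (τ : n ≃ n') (q : n → MaxPlus) : Matrix n n' MaxPlus :=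
  monomial τ.symm fun k => recip (q (τ.symm k))

theorem monomial_mul_inv (τ : n ≃ n') {q : n → MaxPlus} (hq : ∀ j, q j ≠ 0) :
    monomial τ q * monomialInv τ q = 1 := by
  rw [monomialInv, monomial_mul_monomial]
  simp [mul_recip (hq _), monomial_refl_one]

theorem monomialInv_mul (τ : n ≃ n') {q : n → MaxPlus} (hq : ∀ j, q j ≠ 0) :
    monomialInv τ q * monomial τ q = 1 := by
  rw [monomialInv, monomial_mul_monomial]
  simp [recip_mul (hq _), monomial_refl_one]

/-- A monomial matrix as a unit. -/
noncomputable def monomialUnit (τ : n ≃ n) (q : n → MaxPlus) (hq : ∀ j, q j ≠ 0) :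
    (Matrix n n MaxPlus)ˣ where
  val := monomial τ q
  inv := monomialInv τ q
  val_inv := monomial_mul_inv τ hq
  inv_val := monomialInv_mul τ hq

/-- Every invertible tropical matrix is monomial. -/
theorem exists_monomial {U : Matrix n' n MaxPlus} {U' : Matrix n n' MaxPlus} (h : U * U' = 1)
    (h' : U' * U = 1) : ∃ (σ : n ≃ n') (p : n → MaxPlus), (∀ i, p i ≠ 0) ∧ U = monomial σ p := by
  have hU : ColIrredundant U := by
    rw [← Matrix.mul_one U]
    exact colIrredundant_one.mul_left h'
  -- The columns of `U` and the standard basis are both irredundant generating families of the whole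
  -- space.
  obtain ⟨σ, p, hp, e⟩ := hU.exists_equiv colIrredundant_one (Matrix.one_mul _).symm h.symm
  refine ⟨σ, p, hp, Matrix.ext fun i j => ?_⟩
  rw [e, Matrix.one_apply, monomial_apply, ite_mul, one_mul, zero_mul]

theorem exists_eq_monomial (P : (Matrix n n MaxPlus)ˣ) :
    ∃ (τ : n ≃ n) (q : n → MaxPlus), (∀ j, q j ≠ 0) ∧ (P : Matrix n n MaxPlus) = monomial τ q :=
  exists_monomial P.mul_inv P.inv_mul

end Monomial

/-! ### Membership in the group of a matrix -/

section UnitGroup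

variable {m n : Type} [Fintype m] [Fintype n] [DecidableEq m]

theorem exists_eq_mul_of_rightIdeal_le {A B : Matrix m n MaxPlus}
    (h : rightIdeal B ⊆ rightIdeal A) : ∃ X : Matrix n n MaxPlus, B = A * X := by
  classical
  let e := Fintype.equivFin n
  obtain ⟨X, hX⟩ : (⟨_, B.submatrix id e.symm⟩ : Σ k : ℕ, Matrix m (Fin k) MaxPlus) ∈
      rightIdeal A := h ⟨(1 : Matrix n n MaxPlus).submatrix id e.symm, by
    ext i j; simp [Matrix.mul_apply, Matrix.one_apply]⟩
  refine ⟨X.submatrix id e, ?_⟩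
  ext i j
  have := congrFun (congrFun hX i) (e j)
  simpa [Matrix.mul_apply] using this

theorem rightIdeal_mul_le (A : Matrix m n MaxPlus) (X : Matrix n n MaxPlus) :
    rightIdeal (A * X) ⊆ rightIdeal A := by
  rintro ⟨k, Y⟩ ⟨Z, hZ⟩
  exact ⟨X * Z, by rw [← Matrix.mul_assoc]; exact hZ⟩

/-- Left multiplication by a unit never changes the left ideal and respects equality of right
ideals. So only the right ideal matters, and it suffices to test `A` itself. -/
theorem mem_unitGroup_iff {A : Matrix m n MaxPlus} {P : (Matrix m m MaxPlus)ˣ} :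
    P ∈ unitGroup A ↔ (∃ X : Matrix n n MaxPlus, (P : Matrix m m MaxPlus) * A = A * X) ∧
      ∃ Y : Matrix n n MaxPlus, A = (P : Matrix m m MaxPlus) * A * Y := by
  constructor
  · intro h
    have h1 := (h A ⟨rfl, rfl⟩).1
    exact ⟨exists_eq_mul_of_rightIdeal_le h1.le, exists_eq_mul_of_rightIdeal_le h1.ge⟩
  · rintro ⟨⟨X, hX⟩, ⟨Y, hY⟩⟩ B ⟨hB1, hB2⟩
    refine ⟨?_, (leftIdeal_unit_mul P B).trans hB2⟩
    rw [rightIdeal_mul_congr (P : Matrix m m MaxPlus) hB1]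
    refine Set.Subset.antisymm (hX ▸ rightIdeal_mul_le A X) ?_
    conv_lhs => rw [hY]
    exact rightIdeal_mul_le _ _

/-- `P * A` and `A` are irredundant with the same column space, so uniqueness turns the one-sided
factors into an invertible monomial one. -/
theorem ColIrredundant.mem_unitGroup_iff [DecidableEq n] {A : Matrix m n MaxPlus}
    (hA : ColIrredundant A) {P : (Matrix m m MaxPlus)ˣ} :
    P ∈ unitGroup A ↔ ∃ Q : (Matrix n n MaxPlus)ˣ, (P : Matrix m m MaxPlus) * A = A * (Q : Matrix n n MaxPlus) := by
  rw [TropicalMatrix.mem_unitGroup_iff]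
  constructor
  · rintro ⟨⟨X, hX⟩, ⟨Y, hY⟩⟩
    obtain ⟨τ, q, hq, h⟩ := (hA.mul_left P.inv_mul).exists_equiv hA hX hY
    exact ⟨monomialUnit τ q hq, Matrix.ext fun i j => (h i j).trans
      (mul_monomial_apply A τ q i j).symm⟩
  · rintro ⟨Q, hQ⟩
    exact ⟨⟨_, hQ⟩, (↑Q⁻¹ : Matrix n n MaxPlus), by
      rw [hQ, Matrix.mul_assoc, Q.mul_inv, Matrix.mul_one]⟩

end UnitGroup

/-! ### Equivalence of matrices and isomorphism of column spaces -/

section Equivalence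

variable {m n m' n' m'' n'' : Type} [Fintype m] [Fintype n] [Fintype m'] [Fintype n']
  [Fintype m''] [Fintype n''] [DecidableEq m] [DecidableEq n] [DecidableEq m'] [DecidableEq n']
  [DecidableEq m''] [DecidableEq n'']

/-- `B = U A V` with invertible (possibly differently indexed) matrices `U` and `V`. -/
def Equivalent (A : Matrix m n MaxPlus) (B : Matrix m' n' MaxPlus) : Prop :=
  ∃ (U : Matrix m' m MaxPlus) (U' : Matrix m m' MaxPlus) (V : Matrix n n' MaxPlus)
    (V' : Matrix n' n MaxPlus), U * U' = 1 ∧ U' * U = 1 ∧ V * V' = 1 ∧ V' * V = 1 ∧ B = U * A * V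

theorem Equivalent.trans {A : Matrix m n MaxPlus} {B : Matrix m' n' MaxPlus}
    {C : Matrix m'' n'' MaxPlus} (h : Equivalent A B) (h' : Equivalent B C) : Equivalent A C := by
  obtain ⟨U, U', V, V', h1, h2, h3, h4, rfl⟩ := h
  obtain ⟨W, W', Z, Z', h1', h2', h3', h4', rfl⟩ := h'
  refine ⟨W * U, U' * W', V * Z, Z' * V', ?_, ?_, ?_, ?_, ?_⟩
  · rw [Matrix.mul_assoc, ← Matrix.mul_assoc U, h1, Matrix.one_mul, h1']
  · rw [Matrix.mul_assoc, ← Matrix.mul_assoc W', h2', Matrix.one_mul, h2]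
  · rw [Matrix.mul_assoc, ← Matrix.mul_assoc Z, h3', Matrix.one_mul, h3]
  · rw [Matrix.mul_assoc, ← Matrix.mul_assoc V', h4, Matrix.one_mul, h4']
  · simp only [Matrix.mul_assoc]

theorem equivalent_submatrix (A : Matrix m n MaxPlus) (e : m' ≃ m) (f : n' ≃ n) :
    Equivalent A (A.submatrix e f) := by
  refine ⟨(1 : Matrix m m MaxPlus).submatrix e id, (1 : Matrix m m MaxPlus).submatrix id e,
    (1 : Matrix n n MaxPlus).submatrix id f, (1 : Matrix n n MaxPlus).submatrix f id, ?_, ?_, ?_,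
    ?_, ?_⟩
  · rw [← submatrix_mul _ _ e id e Function.bijective_id, Matrix.one_mul, submatrix_one_equiv]
  · rw [← submatrix_mul _ _ id e id e.bijective, Matrix.one_mul, submatrix_id_id]
  · rw [← submatrix_mul _ _ id f id f.bijective, Matrix.one_mul, submatrix_id_id]
  · rw [← submatrix_mul _ _ f id f Function.bijective_id, Matrix.one_mul, submatrix_one_equiv]
  · conv_rhs => rw [← submatrix_id_id A]
    rw [← submatrix_mul _ _ e id id Function.bijective_id,
      ← submatrix_mul _ _ e id f Function.bijective_id, Matrix.one_mul, Matrix.mul_one]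

theorem equivalent_of_monomial {A : Matrix m n MaxPlus} {B : Matrix m' n' MaxPlus} (σ : m ≃ m')
    (τ : n ≃ n') {p : m → MaxPlus} {q : n → MaxPlus} (hp : ∀ i, p i ≠ 0) (hq : ∀ j, q j ≠ 0)
    (h : monomial σ p * A = B * monomial τ q) : Equivalent A B :=
  ⟨monomial σ p, monomialInv σ p, monomialInv τ q, monomial τ q, monomial_mul_inv σ hp,
    monomialInv_mul σ hp, monomialInv_mul τ hq, monomial_mul_inv τ hq, by
      rw [h, Matrix.mul_assoc, monomial_mul_inv τ hq, Matrix.mul_one]⟩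

theorem Equivalent.blockDiagonal' {o : Type} [Fintype o] [DecidableEq o] {m n m' n' : o → Type}
    [∀ i, Fintype (m i)] [∀ i, Fintype (n i)] [∀ i, Fintype (m' i)] [∀ i, Fintype (n' i)]
    [∀ i, DecidableEq (m i)] [∀ i, DecidableEq (n i)] [∀ i, DecidableEq (m' i)]
    [∀ i, DecidableEq (n' i)] {A : ∀ i, Matrix (m i) (n i) MaxPlus}
    {B : ∀ i, Matrix (m' i) (n' i) MaxPlus} (h : ∀ i, Equivalent (A i) (B i)) :
    Equivalent (Matrix.blockDiagonal' A) (Matrix.blockDiagonal' B) := by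
  choose U U' V V' h1 h2 h3 h4 h5 using h
  refine ⟨Matrix.blockDiagonal' U, Matrix.blockDiagonal' U', Matrix.blockDiagonal' V,
    Matrix.blockDiagonal' V', ?_, ?_, ?_, ?_, ?_⟩
  · rw [← blockDiagonal'_mul, funext h1]; exact blockDiagonal'_one
  · rw [← blockDiagonal'_mul, funext h2]; exact blockDiagonal'_one
  · rw [← blockDiagonal'_mul, funext h3]; exact blockDiagonal'_one
  · rw [← blockDiagonal'_mul, funext h4]; exact blockDiagonal'_one
  · rw [← blockDiagonal'_mul, ← blockDiagonal'_mul, funext h5]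

theorem ColIrredundant.mul_right {A : Matrix m n MaxPlus} (hA : ColIrredundant A) (τ : n' ≃ n)
    {q : n' → MaxPlus} (hq : ∀ j, q j ≠ 0) : ColIrredundant (A * monomial τ q) := by
  intro j x hx e
  have h1 : monomial τ q *ᵥ x = fun k => q (τ.symm k) * x (τ.symm k) := by
    funext k
    rw [mulVec, dotProduct, Finset.sum_eq_single (τ.symm k)]
    · simp [monomial_apply]
    · intro l _ hl
      rw [monomial_apply, if_neg, zero_mul]
      rintro rfl
      simp at hl
    · simp
  refine hA (τ j) (recip (q j) • (monomial τ q *ᵥ x)) ?_ ?_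
  · rw [h1]; simp [hx]
  · rw [mulVec_smul, mulVec_mulVec, e]
    funext i
    change recip (q j) * (A * monomial τ q) i j = A i (τ j)
    rw [mul_monomial_apply, mul_comm, mul_assoc, mul_recip (hq j), mul_one]

theorem Equivalent.colIrredundant {A : Matrix m n MaxPlus} {B : Matrix m' n' MaxPlus}
    (h : Equivalent A B) (hA : ColIrredundant A) : ColIrredundant B := by
  obtain ⟨U, U', V, V', h1, h2, h3, h4, rfl⟩ := h
  obtain ⟨τ, q, hq, rfl⟩ := exists_monomial h3 h4
  exact (hA.mul_left h2).mul_right τ hq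

theorem Equivalent.colSpace {A : Matrix m n MaxPlus} {B : Matrix m' n' MaxPlus}
    (h : Equivalent A B) : Nonempty (colSpace A ≃ₗ[MaxPlus] colSpace B) := by
  obtain ⟨U, U', V, V', h1, h2, h3, h4, rfl⟩ := h
  let e : (m → MaxPlus) ≃ₗ[MaxPlus] (m' → MaxPlus) :=
    LinearEquiv.ofLinearMap U.mulVecLin U'.mulVecLin
      (by rw [← mulVecLin_mul, h1, mulVecLin_one]) (by rw [← mulVecLin_mul, h2, mulVecLin_one])
  have : TropicalMatrix.colSpace (U * A * V) = (TropicalMatrix.colSpace A).map (e : (m → MaxPlus) →ₗ[MaxPlus] m' → MaxPlus) := by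
    rw [TropicalMatrix.colSpace, TropicalMatrix.colSpace, ← range_mulVecLin, ← range_mulVecLin]
    ext y
    constructor
    · rintro ⟨x, rfl⟩
      refine ⟨A.mulVecLin (V.mulVecLin x), ⟨_, rfl⟩, ?_⟩
      simp [e, Matrix.mul_assoc]
    · rintro ⟨_, ⟨x, rfl⟩, rfl⟩
      refine ⟨V'.mulVecLin x, ?_⟩
      simp [e, Matrix.mul_assoc, h3]
  rw [this]
  exact ⟨e.submoduleMap _⟩

/-- Matrices with irredundant rows and columns and with isomorphic column spaces are equivalent. -/
theorem equivalent_of_colSpace_equiv {A : Matrix m n MaxPlus} {B : Matrix m' n' MaxPlus}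
    (hA : ColIrredundant A) (hA' : ColIrredundant Aᵀ) (hB : ColIrredundant B)
    (hB' : ColIrredundant Bᵀ) (φ : colSpace A ≃ₗ[MaxPlus] colSpace B) : Equivalent A B := by
  have memA : ∀ x, A *ᵥ x ∈ colSpace A := fun x => by
    rw [colSpace, ← range_mulVecLin]; exact ⟨x, rfl⟩
  have memB : ∀ x, B *ᵥ x ∈ colSpace B := fun x => by
    rw [colSpace, ← range_mulVecLin]; exact ⟨x, rfl⟩
  have exA : ∀ v : colSpace A, ∃ x, v = ⟨A *ᵥ x, memA x⟩ := fun v => by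
    obtain ⟨v, hv⟩ := v
    have hv' := hv
    rw [colSpace, ← range_mulVecLin] at hv'
    obtain ⟨x, rfl⟩ := hv'
    exact ⟨x, rfl⟩
  have exB : ∀ v : colSpace B, ∃ x, v = ⟨B *ᵥ x, memB x⟩ := fun v => by
    obtain ⟨v, hv⟩ := v
    have hv' := hv
    rw [colSpace, ← range_mulVecLin] at hv'
    obtain ⟨x, rfl⟩ := hv'
    exact ⟨x, rfl⟩
  -- `A'` has as columns the images under `φ` of the columns of `A`. It shares its column space with
  -- `B` and, `φ` being injective, its kernel congruence with `A`.
  let L : (n → MaxPlus) →ₗ[MaxPlus] (m' → MaxPlus) :=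
    (colSpace B).subtype ∘ₗ φ.toLinearMap ∘ₗ A.mulVecLin.codRestrict (colSpace A) memA
  set A' : Matrix m' n MaxPlus := LinearMap.toMatrix' L with hA'def
  have hL : ∀ x, A' *ᵥ x = φ ⟨A *ᵥ x, memA x⟩ := fun x => by
    rw [hA'def, LinearMap.toMatrix'_mulVec]; rfl
  have ker : ∀ x y, A *ᵥ x = A *ᵥ y ↔ A' *ᵥ x = A' *ᵥ y := fun x y => by
    rw [hL, hL, SetLike.coe_eq_coe, φ.injective.eq_iff, Subtype.mk_eq_mk]
  have colEq : ∀ {k l : Type} [Fintype l] [DecidableEq l] (M : Matrix k l MaxPlus) (j : l),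
      M.col j = M *ᵥ Pi.single j 1 := fun M j => (mulVec_single_one M j).symm
  have irrA' : ColIrredundant A' := fun j x hx e => by
    rw [colEq, ← ker, ← colEq] at e
    exact hA j x hx e
  obtain ⟨X, hX⟩ : ∃ X : Matrix n' n MaxPlus, A' = B * X := by
    choose x hx using fun j => exB (φ ⟨A *ᵥ Pi.single j 1, memA _⟩)
    refine ⟨(Matrix.of x)ᵀ, Matrix.ext fun i j => ?_⟩
    have h1 := hL (Pi.single j 1)
    rw [hx, ← colEq] at h1
    exact congrFun h1 i
  obtain ⟨Y, hY⟩ : ∃ Y : Matrix n n' MaxPlus, B = A' * Y := by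
    choose y hy using fun j => exA (φ.symm ⟨B *ᵥ Pi.single j 1, memB _⟩)
    refine ⟨(Matrix.of y)ᵀ, Matrix.ext fun i j => ?_⟩
    have h1 : A' *ᵥ y j = B.col j := by rw [hL, ← hy, φ.apply_symm_apply, colEq]
    exact (congrFun h1 i).symm
  obtain ⟨τ, q, hq, hτ⟩ := irrA'.exists_equiv hB hX hY
  have hAB : A' = B * monomial τ q := Matrix.ext fun i j => by rw [hτ, mul_monomial_apply]
  have irrA'row : ColIrredundant A'ᵀ := by
    rw [hAB, transpose_mul]
    refine hB'.mul_left (U' := (monomialInv τ q)ᵀ) ?_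
    rw [← transpose_mul, monomial_mul_inv τ hq, transpose_one]
  -- Equal kernel congruences give equal row spaces by duality, so uniqueness applies to the
  -- transposes.
  obtain ⟨c, hc⟩ : ∃ c : Matrix m' m MaxPlus, A' = c * A := by
    choose c hc using fun i => exists_vecMul_eq (A := A) (a := A' i) hA'.exists_ne_zero
      fun x y h => congrFun ((ker x y).1 h) i
    exact ⟨Matrix.of c, Matrix.ext fun i j => (congrFun (hc i) j).symm⟩
  obtain ⟨d, hd⟩ : ∃ d : Matrix m m' MaxPlus, A = d * A' := by
    choose c hc using fun i => exists_vecMul_eq (A := A') (a := A i) irrA'row.exists_ne_zero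
      fun x y h => congrFun ((ker x y).2 h) i
    exact ⟨Matrix.of c, Matrix.ext fun i j => (congrFun (hc i) j).symm⟩
  obtain ⟨σ, p, hp, hσ⟩ := hA'.exists_equiv irrA'row (X := dᵀ) (Y := cᵀ)
    (by rw [← transpose_mul, ← hd]) (by rw [← transpose_mul, ← hc])
  refine equivalent_of_monomial σ τ (p := fun i => recip (p i)) (fun i => recip_ne_zero (hp i)) hq ?_
  rw [← hAB]
  ext i j
  obtain ⟨i, rfl⟩ := σ.surjective i
  have h1 : A i j = A' (σ i) j * p i := hσ j i
  rw [monomial_mul_apply, h1, mul_comm, mul_assoc, mul_recip (hp i), mul_one]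

/-- Conjugation by the row transformation of an equivalence. -/
theorem Equivalent.unitGroup {A : Matrix m n MaxPlus} {B : Matrix m' n' MaxPlus}
    (h : Equivalent A B) :
    Nonempty (TropicalMatrix.unitGroup A ≃* TropicalMatrix.unitGroup B) := by
  obtain ⟨U, U', V, V', h1, h2, h3, h4, rfl⟩ := h
  have hc : ∀ M N : Matrix m m MaxPlus, U * M * U' * (U * N * U') = U * (M * N) * U' :=
    fun M N => by
      simp only [Matrix.mul_assoc]
      rw [← Matrix.mul_assoc U' U, h2, Matrix.one_mul]
  have hc' : ∀ M N : Matrix m' m' MaxPlus, U' * M * U * (U' * N * U) = U' * (M * N) * U :=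
    fun M N => by
      simp only [Matrix.mul_assoc]
      rw [← Matrix.mul_assoc U U', h1, Matrix.one_mul]
  let e : Matrix m m MaxPlus ≃* Matrix m' m' MaxPlus :=
    { toFun := fun M => U * M * U'
      invFun := fun M => U' * M * U
      left_inv := fun M => by
        change U' * (U * M * U') * U = M
        rw [Matrix.mul_assoc, Matrix.mul_assoc, h2, Matrix.mul_one, ← Matrix.mul_assoc, h2,
          Matrix.one_mul]
      right_inv := fun M => by
        change U * (U' * M * U) * U' = M
        rw [Matrix.mul_assoc, Matrix.mul_assoc, h1, Matrix.mul_one, ← Matrix.mul_assoc, h1,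
          Matrix.one_mul]
      map_mul' := fun M N => (hc M N).symm }
  have hmem : ∀ P : (Matrix m m MaxPlus)ˣ, P ∈ TropicalMatrix.unitGroup A ↔
      Units.mapEquiv e P ∈ TropicalMatrix.unitGroup (U * A * V) := fun P => by
    rw [TropicalMatrix.mem_unitGroup_iff, TropicalMatrix.mem_unitGroup_iff]
    have hP : (Units.mapEquiv e P : Matrix m' m' MaxPlus) * (U * A * V) =
        U * ((P : Matrix m m MaxPlus) * A) * V := by
      change U * (P : Matrix m m MaxPlus) * U' * (U * A * V) = _
      simp only [Matrix.mul_assoc]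
      rw [← Matrix.mul_assoc U' U, h2, Matrix.one_mul]
    rw [hP]
    have hUV : ∀ {M N : Matrix m n MaxPlus}, U * M * V = U * N * V → M = N := fun {M N} h => by
      have := congrArg (fun Z => U' * Z * V') h
      simpa only [Matrix.mul_assoc, h3, Matrix.mul_one, ← Matrix.mul_assoc U' U, h2,
        Matrix.one_mul] using this
    have hr : ∀ (M : Matrix m n MaxPlus) (X : Matrix n n MaxPlus),
        U * M * V * (V' * X * V) = U * (M * X) * V := fun M X => by
      simp only [Matrix.mul_assoc]
      rw [← Matrix.mul_assoc V V', h3, Matrix.one_mul]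
    have hr' : ∀ (M : Matrix m n MaxPlus) (X : Matrix n' n' MaxPlus),
        U * M * V * X = U * (M * (V * X * V')) * V := fun M X => by
      simp only [Matrix.mul_assoc]
      rw [h4, Matrix.mul_one]
    refine and_congr ⟨?_, ?_⟩ ⟨?_, ?_⟩
    · rintro ⟨X, hX⟩
      exact ⟨V' * X * V, by rw [hr, hX]⟩
    · rintro ⟨X, hX⟩
      exact ⟨V * X * V', hUV (by rw [hX, hr'])⟩
    · rintro ⟨X, hX⟩
      refine ⟨V' * X * V, ?_⟩
      rw [hr, ← hX]
    · rintro ⟨X, hX⟩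
      refine ⟨V * X * V', hUV ?_⟩
      rw [← hr']
      exact hX
  exact ⟨((Units.mapEquiv e).subgroupMap _).trans (MulEquiv.subgroupCongr (by
    ext Q
    obtain ⟨P, rfl⟩ := (Units.mapEquiv e).surjective Q
    rw [← hmem]
    exact Subgroup.mem_map_iff_mem (f := (Units.mapEquiv e).toMonoidHom)
      (Units.mapEquiv e).injective))⟩

end Equivalence

end TropicalMatrix

namespace MaxPlus

theorem ofReal_injective : Function.Injective ofReal := fun x y h => by
  have h1 := WithTop.coe_injective (congrArg Tropical.untrop h)
  exact OrderDual.toDual.injective h1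

theorem ofReal_ne_zero (x : ℝ) : ofReal x ≠ 0 := (ne_zero_iff _).2 ⟨x, rfl⟩

end MaxPlus

namespace TropicalMatrix

open MaxPlus Matrix

/-! ### Permutation, weights and mean weight of an invertible matrix -/

section Weights

variable {m : Type} [Fintype m] [DecidableEq m]

/-- The invertible matrix with permutation `σ` and real weights `w`. -/
noncomputable def weightedPerm (σ : Equiv.Perm m) (w : m → ℝ) : (Matrix m m MaxPlus)ˣ :=
  monomialUnit σ (fun j => ofReal (w j)) fun _ => ofReal_ne_zero _

theorem weightedPerm_mul (σ τ : Equiv.Perm m) (v w : m → ℝ) :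
    weightedPerm σ v * weightedPerm τ w = weightedPerm (σ * τ) fun j => v (τ j) + w j :=
  Units.ext (monomial_mul_monomial τ _ σ _)

theorem weightedPerm_one_zero : weightedPerm (1 : Equiv.Perm m) (fun _ => 0) = 1 :=
  Units.ext monomial_refl_one

theorem exists_eq_weightedPerm (P : (Matrix m m MaxPlus)ˣ) :
    ∃ x : Equiv.Perm m × (m → ℝ), P = weightedPerm x.1 x.2 := by
  obtain ⟨τ, q, hq, h⟩ := exists_eq_monomial P
  choose w hw using fun j => (ne_zero_iff (q j)).1 (hq j)
  exact ⟨(τ, w), Units.ext (by rw [h, funext hw]; rfl)⟩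

theorem weightedPerm_injective {σ τ : Equiv.Perm m} {v w : m → ℝ}
    (h : weightedPerm σ v = weightedPerm τ w) : σ = τ ∧ v = w := by
  have key : ∀ j, σ j = τ j ∧ v j = w j := fun j => by
    have h1 : monomial σ (fun j => ofReal (v j)) (σ j) j =
        monomial τ (fun j => ofReal (w j)) (σ j) j := 
      congrArg (fun U : (Matrix m m MaxPlus)ˣ => (U : Matrix m m MaxPlus) (σ j) j) h
    rw [monomial_apply, monomial_apply, if_pos rfl] at h1
    split_ifs at h1 with h2
    · exact ⟨h2, ofReal_injective h1⟩
    · exact absurd h1 (ofReal_ne_zero _)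
  exact ⟨Equiv.ext fun j => (key j).1, funext fun j => (key j).2⟩

/-- The permutation underlying an invertible matrix. -/
noncomputable def permOf (P : (Matrix m m MaxPlus)ˣ) : Equiv.Perm m :=
  (exists_eq_weightedPerm P).choose.1

/-- The real weights of an invertible matrix, indexed by columns. -/
noncomputable def weightOf (P : (Matrix m m MaxPlus)ˣ) : m → ℝ :=
  (exists_eq_weightedPerm P).choose.2

theorem eq_weightedPerm (P : (Matrix m m MaxPlus)ˣ) : P = weightedPerm (permOf P) (weightOf P) :=
  (exists_eq_weightedPerm P).choose_spec

theorem permOf_weightedPerm (σ : Equiv.Perm m) (w : m → ℝ) : permOf (weightedPerm σ w) = σ :=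
  (weightedPerm_injective (eq_weightedPerm (weightedPerm σ w))).1.symm

theorem weightOf_weightedPerm (σ : Equiv.Perm m) (w : m → ℝ) : weightOf (weightedPerm σ w) = w :=
  (weightedPerm_injective (eq_weightedPerm (weightedPerm σ w))).2.symm

theorem mul_eq_weightedPerm (P Q : (Matrix m m MaxPlus)ˣ) :
    P * Q = weightedPerm (permOf P * permOf Q) fun j =>
      weightOf P (permOf Q j) + weightOf Q j := by
  conv_lhs => rw [eq_weightedPerm P, eq_weightedPerm Q, weightedPerm_mul]

theorem weightOf_mul (P Q : (Matrix m m MaxPlus)ˣ) (j : m) :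
    weightOf (P * Q) j = weightOf P (permOf Q j) + weightOf Q j := by
  rw [mul_eq_weightedPerm, weightOf_weightedPerm]

/-- The underlying permutation as a homomorphism. -/
noncomputable def permHom : (Matrix m m MaxPlus)ˣ →* Equiv.Perm m :=
  MonoidHom.mk' permOf fun P Q => by rw [mul_eq_weightedPerm, permOf_weightedPerm]

/-- The mean weight of an invertible matrix. -/
noncomputable def meanHom : (Matrix m m MaxPlus)ˣ →* Multiplicative ℝ :=
  MonoidHom.mk' (fun P => Multiplicative.ofAdd ((∑ j, weightOf P j) / Fintype.card m))
    fun P Q => by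
      simp only [weightOf_mul, Finset.sum_add_distrib, Equiv.sum_comp, add_div]
      rfl

/-- The invertible scalar matrices. -/
noncomputable def scalarHom : Multiplicative ℝ →* (Matrix m m MaxPlus)ˣ :=
  MonoidHom.mk' (fun x => weightedPerm 1 fun _ => Multiplicative.toAdd x) fun x y => by
    rw [weightedPerm_mul]; rfl

theorem meanHom_scalarHom [Nonempty m] (x : Multiplicative ℝ) :
    meanHom (scalarHom x : (Matrix m m MaxPlus)ˣ) = x := by
  change Multiplicative.ofAdd ((∑ j : m, weightOf (weightedPerm 1 fun _ => x.toAdd) j) / _) = x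
  rw [weightOf_weightedPerm]
  simp

theorem scalarHom_mul_matrix {n : Type} (x : Multiplicative ℝ) (M : Matrix m n MaxPlus) :
    ((scalarHom x : (Matrix m m MaxPlus)ˣ) : Matrix m m MaxPlus) * M = ofReal x.toAdd • M := by
  ext i j
  exact monomial_mul_apply M (Equiv.refl m) _ i j

theorem matrix_mul_scalarHom {n : Type} (x : Multiplicative ℝ) (M : Matrix n m MaxPlus) :
    M * ((scalarHom x : (Matrix m m MaxPlus)ˣ) : Matrix m m MaxPlus) = ofReal x.toAdd • M := by
  ext i j
  exact (mul_monomial_apply M (Equiv.refl m) _ i j).trans (mul_comm _ _)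

theorem scalarHom_commute (x : Multiplicative ℝ) (P : (Matrix m m MaxPlus)ˣ) :
    scalarHom x * P = P * scalarHom x :=
  Units.ext (by rw [Units.val_mul, Units.val_mul, scalarHom_mul_matrix, matrix_mul_scalarHom])

theorem weightOf_pow {P : (Matrix m m MaxPlus)ˣ} (h : permHom P = 1) (k : ℕ) (j : m) :
    weightOf (P ^ k) j = k * weightOf P j := by
  induction k with
  | zero =>
    rw [pow_zero, ← weightedPerm_one_zero, weightOf_weightedPerm]
    simp
  | succ k ih =>
    have h' : permOf P = 1 := h
    rw [pow_succ, weightOf_mul, h', Equiv.Perm.one_apply, ih]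
    push_cast
    ring

end Weights

/-! ### The group of a connected matrix -/

section Connected

variable {m n : Type} [Fintype m] [Fintype n] [DecidableEq m] [DecidableEq n]

/-- Functions on rows and columns that agree along nonzero entries are constant on rows. -/
def RowConnected (A : Matrix m n MaxPlus) : Prop :=
  ∀ (α : Type) (f : m → α) (g : n → α), (∀ i j, A i j ≠ 0 → f i = g j) → ∀ i i', f i = f i'

/-- A common power of `P` and `Q` in `P A = A Q` is diagonal on both sides. Each finite entry of `A`
equates a row weight with a column weight, and connectedness makes the row weights constant. -/
theorem exists_pow_eq_scalarHom [Nonempty m] {A : Matrix m n MaxPlus} (hA : ColIrredundant A)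
    (hc : RowConnected A) {P : (Matrix m m MaxPlus)ˣ} (hP : P ∈ unitGroup A) :
    ∃ (k : ℕ) (d : Multiplicative ℝ), 0 < k ∧ P ^ k = scalarHom d := by
  obtain ⟨Q, hQ⟩ := hA.mem_unitGroup_iff.1 hP
  set k := Fintype.card (Equiv.Perm m) * Fintype.card (Equiv.Perm n) with hk
  have hpow : ∀ k : ℕ, (↑(P ^ k) : Matrix m m MaxPlus) * A = A * (↑(Q ^ k) : Matrix n n MaxPlus) :=
    fun k => by
      induction k with
      | zero => simp
      | succ k ih =>
        rw [pow_succ, pow_succ', Units.val_mul, Units.val_mul, Matrix.mul_assoc, hQ,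
          ← Matrix.mul_assoc, ih, Matrix.mul_assoc, ← Units.val_mul, ← Units.val_mul,
          ← pow_succ, ← pow_succ']
  have h1 : permOf (P ^ k) = 1 := by
    change permHom (P ^ k) = 1
    rw [map_pow, hk, pow_mul, pow_card_eq_one, one_pow]
  have h2 : permOf (Q ^ k) = 1 := by
    change permHom (Q ^ k) = 1
    rw [map_pow, hk, pow_mul', pow_card_eq_one, one_pow]
  have h3 := hpow k
  rw [eq_weightedPerm (P ^ k), eq_weightedPerm (Q ^ k), h1, h2] at h3
  have h4 : ∀ i j, ofReal (weightOf (P ^ k) i) * A i j = A i j * ofReal (weightOf (Q ^ k) j) :=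
    fun i j => (monomial_mul_apply A (Equiv.refl m) _ i j).symm.trans
      ((congrFun (congrFun h3 i) j).trans (mul_monomial_apply A (Equiv.refl n) _ i j))
  have h5 := hc ℝ (weightOf (P ^ k)) (weightOf (Q ^ k)) fun i j hij =>
    ofReal_injective (mul_left_cancel hij ((mul_comm _ _).trans (h4 i j)))
  refine ⟨k, Multiplicative.ofAdd (weightOf (P ^ k) (Classical.arbitrary m)),
    Nat.mul_pos Fintype.card_pos Fintype.card_pos, ?_⟩
  conv_lhs => rw [eq_weightedPerm (P ^ k), h1]
  exact congrArg _ (funext fun i => h5 _ _)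

theorem meanHom_eq_one_of_pow [Nonempty m] {P : (Matrix m m MaxPlus)ˣ} {k : ℕ} (hk : 0 < k)
    {d : Multiplicative ℝ} (h : P ^ k = scalarHom d) : meanHom P = 1 ↔ d = 1 := by
  have h1 := congrArg meanHom h
  rw [map_pow, meanHom_scalarHom] at h1
  rw [← h1]
  refine ⟨fun e => by rw [e, one_pow], fun e => ?_⟩
  have e' : (k : ℝ) * (meanHom P).toAdd = 0 := by
    have := congrArg Multiplicative.toAdd e
    rwa [toAdd_pow, nsmul_eq_mul] at this
  exact (mul_eq_zero.1 e').resolve_left (by exact_mod_cast hk.ne')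

/-- With `P ^ k` scalar, a fixed vector forces the scalar to be trivial. Conversely, if `P ^ k = 1`,
summing the orbit of a vector produces a fixed vector. -/
theorem hasEigenvalue_zero_iff [Nonempty m] {A : Matrix m n MaxPlus} (hA : ColIrredundant A)
    (hc : RowConnected A) {P : (Matrix m m MaxPlus)ˣ} (hP : P ∈ unitGroup A) :
    HasEigenvalue (P : Matrix m m MaxPlus) (ofReal 0) ↔ meanHom P = 1 := by
  obtain ⟨k, d, hk, h⟩ := exists_pow_eq_scalarHom hA hc hP
  rw [meanHom_eq_one_of_pow hk h]
  constructor
  · rintro ⟨x, hx, hPx⟩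
    rw [ofReal_zero, one_smul] at hPx
    have h1 : ∀ k : ℕ, (↑(P ^ k) : Matrix m m MaxPlus) *ᵥ x = x := fun k => by
      induction k with
      | zero => simp
      | succ k ih => rw [pow_succ, Units.val_mul, ← mulVec_mulVec, hPx, ih]
    have h2 := h1 k
    obtain ⟨i, hi⟩ := Function.ne_iff.1 hx
    have h3 : ofReal d.toAdd * x i = x i := by
      conv_rhs => rw [← h2, h, ← Matrix.mul_one ((scalarHom d : (Matrix m m MaxPlus)ˣ) :
        Matrix m m MaxPlus), scalarHom_mul_matrix, smul_mulVec, one_mulVec]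
      rfl
    exact ofReal_injective (mul_left_cancel hi
      ((mul_comm _ _).trans (h3.trans (mul_one _).symm)))
  · rintro rfl
    rw [map_one] at h
    -- Here `1` is the vector of real zeros. Its term at `l = 0` keeps the orbit sum away from `-∞`.
    refine ⟨∑ l ∈ Finset.range k, (↑(P ^ l) : Matrix m m MaxPlus) *ᵥ 1, fun h0 => ?_, ?_⟩
    · have i := Classical.arbitrary m
      have h1 := congrFun h0 i
      rw [Finset.sum_apply] at h1
      have h2 := sum_le (f := fun l => ((↑(P ^ l) : Matrix m m MaxPlus) *ᵥ 1) i)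
        (Finset.mem_range.2 hk)
      rw [h1, pow_zero, Units.val_one, one_mulVec] at h2
      exact (lt_zero (one_ne_zero (α := MaxPlus))).not_ge h2
    · rw [ofReal_zero, one_smul, mulVec_sum]
      have h1 : ∀ l, (P : Matrix m m MaxPlus) *ᵥ ((↑(P ^ l) : Matrix m m MaxPlus) *ᵥ 1) =
          (↑(P ^ (l + 1)) : Matrix m m MaxPlus) *ᵥ 1 := fun l => by
        rw [mulVec_mulVec, pow_succ', Units.val_mul]
      simp only [h1]
      obtain ⟨k, rfl⟩ := Nat.exists_eq_succ_of_ne_zero hk.ne'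
      rw [Finset.sum_range_succ, Finset.sum_range_succ', h, pow_zero]

/-- The elements of `unitGroup A` of mean weight zero. -/
noncomputable def zeroMeanGroup (A : Matrix m n MaxPlus) : Subgroup (Matrix m m MaxPlus)ˣ :=
  unitGroup A ⊓ (meanHom (m := m)).ker

theorem coe_zeroMeanGroup [Nonempty m] {A : Matrix m n MaxPlus} (hA : ColIrredundant A)
    (hc : RowConnected A) : (zeroMeanGroup A : Set (Matrix m m MaxPlus)ˣ) = zeroEigenSet A := by
  ext P
  exact and_congr_right fun hP => (hasEigenvalue_zero_iff hA hc hP).symm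

/-- An element of mean zero has finite order. If its permutation is trivial as well, powers multiply
its weights, so these vanish. -/
theorem permHom_zeroMeanGroup_injective [Nonempty m] {A : Matrix m n MaxPlus}
    (hA : ColIrredundant A) (hc : RowConnected A) :
    Function.Injective (permHom.comp (zeroMeanGroup A).subtype) := by
  rw [injective_iff_map_eq_one]
  rintro ⟨P, hP, hm⟩ h1
  obtain ⟨k, d, hk, h⟩ := exists_pow_eq_scalarHom hA hc hP
  have hd := (meanHom_eq_one_of_pow hk h).1 hm
  rw [hd, map_one] at h
  have h1' : permHom P = 1 := h1
  have hw : weightOf P = fun _ => 0 := funext fun j => by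
    have h2 := weightOf_pow h1' k j
    rw [h, ← weightedPerm_one_zero, weightOf_weightedPerm] at h2
    exact (mul_eq_zero.1 h2.symm).resolve_left (by exact_mod_cast hk.ne')
  refine Subtype.ext ?_
  change P = 1
  rw [eq_weightedPerm P, hw, show permOf P = 1 from h1', weightedPerm_one_zero]

theorem scalarHom_mem_unitGroup {A : Matrix m n MaxPlus} (hA : ColIrredundant A)
    (x : Multiplicative ℝ) : scalarHom x ∈ unitGroup A :=
  hA.mem_unitGroup_iff.2 ⟨scalarHom x, by rw [scalarHom_mul_matrix, matrix_mul_scalarHom]⟩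

/-- For a connected matrix the unit group splits as the scalars times the zero-mean part. -/
theorem unitGroup_equiv_prod [Nonempty m] {A : Matrix m n MaxPlus} (hA : ColIrredundant A) :
    Nonempty (unitGroup A ≃* Multiplicative ℝ × zeroMeanGroup A) := by
  let φ : Multiplicative ℝ × zeroMeanGroup A →* unitGroup A :=
    MonoidHom.mk' (fun x => ⟨scalarHom x.1 * (x.2 : (Matrix m m MaxPlus)ˣ),
      mul_mem (scalarHom_mem_unitGroup hA x.1) x.2.2.1⟩)
      fun x y => Subtype.ext (by
        change scalarHom (x.1 * y.1) * ((x.2 : (Matrix m m MaxPlus)ˣ) * (y.2 : (Matrix m m MaxPlus)ˣ)) =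
          scalarHom x.1 * (x.2 : (Matrix m m MaxPlus)ˣ) *
            (scalarHom y.1 * (y.2 : (Matrix m m MaxPlus)ˣ))
        rw [map_mul, mul_assoc, mul_assoc, ← mul_assoc (scalarHom y.1),
          scalarHom_commute y.1, mul_assoc])
  have hmean : ∀ x, meanHom (φ x : (Matrix m m MaxPlus)ˣ) = x.1 := fun x => by
    change meanHom (scalarHom x.1 * (x.2 : (Matrix m m MaxPlus)ˣ)) = x.1
    rw [map_mul, meanHom_scalarHom, show meanHom (x.2 : (Matrix m m MaxPlus)ˣ) = 1 from x.2.2.2,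
      mul_one]
  refine ⟨(MulEquiv.ofBijective φ ⟨fun x y h => ?_, fun P => ?_⟩).symm⟩
  · have h1 : x.1 = y.1 := by rw [← hmean x, h, hmean y]
    refine Prod.ext h1 (Subtype.ext ?_)
    have h2 : scalarHom x.1 * (x.2 : (Matrix m m MaxPlus)ˣ) =
        scalarHom y.1 * (y.2 : (Matrix m m MaxPlus)ˣ) :=
      congrArg Subtype.val h
    rw [h1] at h2
    exact _root_.mul_left_cancel h2
  · refine ⟨(meanHom P.1, ⟨(scalarHom (meanHom P.1))⁻¹ * P.1,
      (unitGroup A).mul_mem ((unitGroup A).inv_mem (scalarHom_mem_unitGroup hA _)) P.2, ?_⟩), Subtype.ext ?_⟩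
    · change meanHom _ = 1
      rw [map_mul, map_inv, meanHom_scalarHom, inv_mul_cancel]
    · exact mul_inv_cancel_left _ _

end Connected

/-! ### Block permutation matrices -/

section WreathMatrix

variable {a b c N : Type} [Fintype a] [Fintype b] [Fintype c] [Fintype N] [DecidableEq N]

/-- The block matrix with block `f j` in block row `j` and block column `s.symm j`. -/
def wreathMatrix (s : Equiv.Perm N) (f : N → Matrix a b MaxPlus) :
    Matrix (a × N) (b × N) MaxPlus :=
  Matrix.of fun x y => if x.2 = s y.2 then f x.2 x.1 y.1 else 0

theorem wreathMatrix_apply (s : Equiv.Perm N) (f : N → Matrix a b MaxPlus) (x : a × N)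
    (y : b × N) : wreathMatrix s f x y = if x.2 = s y.2 then f x.2 x.1 y.1 else 0 := rfl

/-- This is the multiplication rule of the wreath product; indexing blocks by their row makes the
twist `s.symm` agree with `mulAutArrow`. -/
theorem wreathMatrix_mul (s t : Equiv.Perm N) (f : N → Matrix a b MaxPlus)
    (g : N → Matrix b c MaxPlus) :
    wreathMatrix s f * wreathMatrix t g = wreathMatrix (s * t) fun j => f j * g (s.symm j) := by
  ext ⟨x, j⟩ ⟨z, l⟩
  rw [wreathMatrix_apply, Matrix.mul_apply, Fintype.sum_prod_type_right,
    Finset.sum_eq_single (s.symm j)]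
  · simp only [wreathMatrix_apply, Equiv.apply_symm_apply, if_true, Equiv.Perm.mul_apply]
    by_cases h : j = s (t l)
    · refine Eq.trans ?_ (if_pos h).symm
      rw [Matrix.mul_apply]
      refine Finset.sum_congr rfl fun y _ => ?_
      rw [if_pos (by rw [h, Equiv.symm_apply_apply])]
    · refine Eq.trans ?_ (if_neg h).symm
      refine Finset.sum_eq_zero fun y _ => ?_
      rw [if_neg (fun e => h (by rw [← e, Equiv.apply_symm_apply])), mul_zero]
  · intro i _ hi
    refine Finset.sum_eq_zero fun y _ => ?_
    rw [wreathMatrix_apply, if_neg, zero_mul]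
    rintro h
    exact hi (by rw [show j = s i from h, Equiv.symm_apply_apply])
  · simp

theorem blockDiagonal_eq_wreathMatrix (f : N → Matrix a b MaxPlus) :
    Matrix.blockDiagonal f = wreathMatrix 1 f := by
  ext x y
  rw [blockDiagonal_apply, wreathMatrix_apply]
  rfl

theorem wreathMatrix_one [DecidableEq a] :
    wreathMatrix (1 : Equiv.Perm N) (fun _ => (1 : Matrix a a MaxPlus)) = 1 := by
  rw [← blockDiagonal_eq_wreathMatrix]
  exact blockDiagonal_one

end WreathMatrix

/-! ### The group of a block diagonal matrix with repeated blocks -/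

section RepeatDiag

variable {o : Type} [Fintype o] [DecidableEq o] {R S T : o → Type} [∀ i, Fintype (R i)]
  [∀ i, DecidableEq (R i)] [∀ i, Fintype (S i)] [∀ i, DecidableEq (S i)] [∀ i, Fintype (T i)]
  [∀ i, DecidableEq (T i)] {n : o → ℕ}

/-- The block diagonal matrix in which the matrix `A i` is repeated `n i` times. -/
def repeatDiag (n : o → ℕ) (A : ∀ i, Matrix (R i) (S i) MaxPlus) :
    Matrix (Σ i, R i × Fin (n i)) (Σ i, S i × Fin (n i)) MaxPlus :=
  Matrix.blockDiagonal' fun i => Matrix.blockDiagonal fun _ : Fin (n i) => A i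

/-- The block in position `(x, y)` of a matrix. -/
def block (x y : Σ i, Fin (n i))
    (M : Matrix (Σ i, R i × Fin (n i)) (Σ i, S i × Fin (n i)) MaxPlus) :
    Matrix (R x.1) (S y.1) MaxPlus :=
  Matrix.of fun a b => M ⟨x.1, (a, x.2)⟩ ⟨y.1, (b, y.2)⟩

theorem block_mul (x z : Σ i, Fin (n i))
    (M : Matrix (Σ i, R i × Fin (n i)) (Σ i, S i × Fin (n i)) MaxPlus)
    (N : Matrix (Σ i, S i × Fin (n i)) (Σ i, T i × Fin (n i)) MaxPlus) :
    block x z (M * N) = ∑ y, block x y M * block y z N := by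
  ext a b
  rw [Matrix.sum_apply]
  change (M * N) _ _ = _
  rw [Matrix.mul_apply, Fintype.sum_sigma, Fintype.sum_sigma]
  refine Finset.sum_congr rfl fun i _ => ?_
  rw [Fintype.sum_prod_type_right]
  rfl

theorem block_one_self (x : Σ i, Fin (n i)) :
    block x x (1 : Matrix (Σ i, R i × Fin (n i)) (Σ i, R i × Fin (n i)) MaxPlus) = 1 := by
  ext a b
  simp [block, Matrix.one_apply]

theorem block_repeatDiag_self (A : ∀ i, Matrix (R i) (S i) MaxPlus) (x : Σ i, Fin (n i)) :
    block x x (repeatDiag n A) = A x.1 := by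
  ext a b
  simp [block, repeatDiag, blockDiagonal'_apply, blockDiagonal_apply]

theorem repeatDiag_ne_zero {A : ∀ i, Matrix (R i) (S i) MaxPlus} {y : Σ i, R i × Fin (n i)}
    {z : Σ i, S i × Fin (n i)} (h : repeatDiag n A y z ≠ 0) :
    (⟨y.1, y.2.2⟩ : Σ i, Fin (n i)) = ⟨z.1, z.2.2⟩ := by
  obtain ⟨i, a, j⟩ := y
  obtain ⟨i', b, j'⟩ := z
  rw [repeatDiag, blockDiagonal'_apply] at h
  split_ifs at h with h1
  · change i = i' at h1
    subst h1
    rw [blockDiagonal_apply] at h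
    split_ifs at h with h2
    · change j = j' at h2
      subst h2
      rfl
    · exact absurd rfl h
  · exact absurd rfl h

theorem block_repeatDiag_of_ne (A : ∀ i, Matrix (R i) (S i) MaxPlus) {x y : Σ i, Fin (n i)}
    (h : x ≠ y) : block x y (repeatDiag n A) = 0 := by
  ext a b
  by_contra h0
  exact h (repeatDiag_ne_zero (A := A) (y := ⟨x.1, (a, x.2)⟩) (z := ⟨y.1, (b, y.2)⟩) h0)

theorem block_mul_repeatDiag {A : ∀ i, Matrix (R i) (S i) MaxPlus} (x y : Σ i, Fin (n i))
    (M : Matrix (Σ i, T i × Fin (n i)) (Σ i, R i × Fin (n i)) MaxPlus) :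
    block x y (M * repeatDiag n A) = block x y M * A y.1 := by
  rw [block_mul, Finset.sum_eq_single y, block_repeatDiag_self]
  · intro z _ hz
    rw [block_repeatDiag_of_ne A hz, Matrix.mul_zero]
  · simp

theorem block_repeatDiag_mul {A : ∀ i, Matrix (R i) (S i) MaxPlus} (x y : Σ i, Fin (n i))
    (M : Matrix (Σ i, S i × Fin (n i)) (Σ i, T i × Fin (n i)) MaxPlus) :
    block x y (repeatDiag n A * M) = A x.1 * block x y M := by
  rw [block_mul, Finset.sum_eq_single x, block_repeatDiag_self]
  · intro z _ hz
    rw [block_repeatDiag_of_ne A hz.symm, Matrix.zero_mul]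
  · simp

/-- The permutations of `P` and `Q` carry finite entries to finite entries, each inside one diagonal
block. Hence the block receiving a row is constant along finite entries, and connectedness makes it
depend only on the source block. -/
theorem exists_block_map [∀ i, Nonempty (R i)] {A : ∀ i, Matrix (R i) (S i) MaxPlus}
    (hA : ∀ i, ColIrredundant (A i)) (hc : ∀ i, RowConnected (A i))
    {P : (Matrix (Σ i, R i × Fin (n i)) (Σ i, R i × Fin (n i)) MaxPlus)ˣ}
    {Q : (Matrix (Σ i, S i × Fin (n i)) (Σ i, S i × Fin (n i)) MaxPlus)ˣ}
    (h : P.val * repeatDiag n A = repeatDiag n A * Q.val) :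
    ∃ π : (Σ i, Fin (n i)) → Σ i, Fin (n i),
      ∀ x y, x ≠ π y → block x y P.val = 0 ∧ block x y Q.val = 0 := by
  obtain ⟨σ, p, hp, hP⟩ := exists_eq_monomial P
  obtain ⟨τ, q, hq, hQ⟩ := exists_eq_monomial Q
  rw [hP, hQ] at h ⊢
  have hpq : ∀ y z, p y * repeatDiag n A y z = repeatDiag n A (σ y) (τ z) * q z := fun y z => by
    rw [← monomial_mul_apply _ σ, h, mul_monomial_apply]
  let f : ∀ x : Σ i, Fin (n i), R x.1 → Σ i, Fin (n i) := fun x a =>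
    ⟨(σ ⟨x.1, (a, x.2)⟩).1, (σ ⟨x.1, (a, x.2)⟩).2.2⟩
  let g : ∀ x : Σ i, Fin (n i), S x.1 → Σ i, Fin (n i) := fun x b =>
    ⟨(τ ⟨x.1, (b, x.2)⟩).1, (τ ⟨x.1, (b, x.2)⟩).2.2⟩
  have hfg : ∀ x a b, A x.1 a b ≠ 0 → f x a = g x b := fun x a b hab => by
    refine repeatDiag_ne_zero (A := A) fun h0 => ?_
    have h1 := hpq ⟨x.1, (a, x.2)⟩ ⟨x.1, (b, x.2)⟩
    rw [h0, zero_mul] at h1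
    refine mul_ne_zero (hp _) ?_ h1
    have h2 := congrFun (congrFun (block_repeatDiag_self A x) a) b
    exact fun h3 => hab (h2.symm.trans h3)
  have hf : ∀ x a a', f x a = f x a' := fun x => hc x.1 _ (f x) (g x) (hfg x)
  refine ⟨fun x => f x (Classical.arbitrary _), fun x y hxy => ⟨?_, ?_⟩⟩
  · ext a b
    change monomial σ p _ _ = 0
    rw [monomial_apply, if_neg]
    intro e
    refine hxy (.trans ?_ (hf y b _))
    change x = ⟨(σ _).1, (σ _).2.2⟩
    rw [← e]
  · ext a b
    change monomial τ q _ _ = 0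
    rw [monomial_apply, if_neg]
    intro e
    obtain ⟨a', ha'⟩ := (hA y.1).exists_ne_zero b
    refine hxy (.trans ?_ (hf y a' _))
    rw [hfg y a' b ha']
    change x = ⟨(τ _).1, (τ _).2.2⟩
    rw [← e]

theorem block_mul_of_map {π : (Σ i, Fin (n i)) → Σ i, Fin (n i)}
    {M : Matrix (Σ i, R i × Fin (n i)) (Σ i, S i × Fin (n i)) MaxPlus}
    {N : Matrix (Σ i, S i × Fin (n i)) (Σ i, T i × Fin (n i)) MaxPlus} {z : Σ i, Fin (n i)}
    (h : ∀ x y, x ≠ π y → block x y N = 0) (x : Σ i, Fin (n i)) :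
    block x z (M * N) = block x (π z) M * block (π z) z N := by
  rw [block_mul, Finset.sum_eq_single (π z)]
  · intro y _ hy
    rw [h y z hy, Matrix.mul_zero]
  · simp

/-- The block maps of `P` and `P⁻¹` are mutually inverse, since otherwise a diagonal block of the
identity, which is nonempty, would vanish. -/
theorem exists_block_perm [∀ i, Nonempty (R i)] {A : ∀ i, Matrix (R i) (S i) MaxPlus}
    (hA : ∀ i, ColIrredundant (A i)) (hc : ∀ i, RowConnected (A i))
    {P : (Matrix (Σ i, R i × Fin (n i)) (Σ i, R i × Fin (n i)) MaxPlus)ˣ}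
    {Q : (Matrix (Σ i, S i × Fin (n i)) (Σ i, S i × Fin (n i)) MaxPlus)ˣ}
    (h : P.val * repeatDiag n A = repeatDiag n A * Q.val) :
    ∃ π : Equiv.Perm (Σ i, Fin (n i)),
      (∀ x y, x ≠ π y → block x y P.val = 0 ∧ block x y Q.val = 0) ∧
      (∀ x y, x ≠ π.symm y → block x y P⁻¹.val = 0 ∧ block x y Q⁻¹.val = 0) := by
  have h' : P⁻¹.val * repeatDiag n A = repeatDiag n A * Q⁻¹.val := by
    calc P⁻¹.val * repeatDiag n A = P⁻¹.val * (repeatDiag n A * Q.val) * Q⁻¹.val := by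
          rw [Matrix.mul_assoc, Matrix.mul_assoc, Q.mul_inv, Matrix.mul_one]
      _ = _ := by rw [← h, ← Matrix.mul_assoc P⁻¹.val, P.inv_mul, Matrix.one_mul]
  obtain ⟨π, hπ⟩ := exists_block_map hA hc h
  obtain ⟨ρ, hρ⟩ := exists_block_map hA hc h'
  have hinv : ∀ {π ρ : (Σ i, Fin (n i)) → Σ i, Fin (n i)}
      {M N : Matrix (Σ i, R i × Fin (n i)) (Σ i, R i × Fin (n i)) MaxPlus},
      (∀ x y, x ≠ π y → block x y M = 0) → (∀ x y, x ≠ ρ y → block x y N = 0) → M * N = 1 →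
      ∀ x, π (ρ x) = x := fun {π ρ M N} hM hN hMN x => by
    by_contra hne
    have h1 := block_mul_of_map (M := M) hN (z := x) x
    rw [hMN, block_one_self, hM x (ρ x) (Ne.symm hne), Matrix.zero_mul] at h1
    exact one_ne_zero h1
  have h1 := hinv (fun x y hxy => (hπ x y hxy).1) (fun x y hxy => (hρ x y hxy).1) P.mul_inv
  have h2 := hinv (fun x y hxy => (hρ x y hxy).1) (fun x y hxy => (hπ x y hxy).1) P.inv_mul
  exact ⟨⟨π, ρ, h2, h1⟩, hπ, hρ⟩

theorem exists_sigma_perm {π : Equiv.Perm (Σ i, Fin (n i))} (h : ∀ x, (π x).1 = x.1) :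
    ∃ s : ∀ i, Equiv.Perm (Fin (n i)), ∀ i j, π ⟨i, j⟩ = ⟨i, s i j⟩ := by
  have h1 : ∀ i (j : Fin (n i)), ∃ l : Fin (n i), π ⟨i, j⟩ = ⟨i, l⟩ := fun i j => by
    rcases hx : π ⟨i, j⟩ with ⟨i', l⟩
    have h2 := h ⟨i, j⟩
    rw [hx] at h2
    change i' = i at h2
    subst h2
    exact ⟨l, rfl⟩
  choose s hs using h1
  refine ⟨fun i => Equiv.ofBijective (s i) (Finite.injective_iff_bijective.1 fun j l e => ?_), hs⟩
  have h2 : π ⟨i, j⟩ = π ⟨i, l⟩ := by rw [hs, hs, e]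
  exact eq_of_heq (Sigma.mk.inj_iff.1 (π.injective h2)).2

/-- The wreath products of the unit groups of the `A i` act by invertible matrices. -/
noncomputable def wreathHom (n : o → ℕ) (A : ∀ i, Matrix (R i) (S i) MaxPlus) :
    (∀ i, SymmWreath (unitGroup (A i)) (n i)) →*
      (Matrix (Σ i, R i × Fin (n i)) (Σ i, R i × Fin (n i)) MaxPlus)ˣ :=
  MonoidHom.toHomUnits
    { toFun := fun w => Matrix.blockDiagonal' fun i =>
        wreathMatrix (w i).right fun j => ((w i).left j).1.val
      map_one' := by
        refine (congrArg Matrix.blockDiagonal' (funext fun i => ?_)).trans blockDiagonal'_one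
        exact wreathMatrix_one
      map_mul' := fun w v => by
        rw [← blockDiagonal'_mul]
        refine congrArg Matrix.blockDiagonal' (funext fun i => ?_)
        rw [wreathMatrix_mul]
        rfl }

theorem wreathHom_val (A : ∀ i, Matrix (R i) (S i) MaxPlus)
    (w : ∀ i, SymmWreath (unitGroup (A i)) (n i)) :
    (wreathHom n A w).val = Matrix.blockDiagonal' fun i =>
      wreathMatrix (w i).right fun j => ((w i).left j).1.val := rfl

theorem wreathHom_mem (A : ∀ i, Matrix (R i) (S i) MaxPlus)
    (w : ∀ i, SymmWreath (unitGroup (A i)) (n i)) :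
    wreathHom n A w ∈ unitGroup (repeatDiag n A) := by
  have key : ∀ w : ∀ i, SymmWreath (unitGroup (A i)) (n i),
      ∃ X : Matrix (Σ i, S i × Fin (n i)) (Σ i, S i × Fin (n i)) MaxPlus,
        (wreathHom n A w).val * repeatDiag n A = repeatDiag n A * X := fun w => by
    choose X hX using fun i j => (mem_unitGroup_iff.1 ((w i).left j).2).1
    refine ⟨Matrix.blockDiagonal' fun i => wreathMatrix (w i).right (X i), ?_⟩
    rw [wreathHom_val, repeatDiag, ← blockDiagonal'_mul, ← blockDiagonal'_mul]
    refine congrArg Matrix.blockDiagonal' (funext fun i => ?_)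
    rw [blockDiagonal_eq_wreathMatrix, wreathMatrix_mul, wreathMatrix_mul, mul_one, one_mul,
      funext (hX i)]
    rfl
  refine mem_unitGroup_iff.2 ⟨key w, ?_⟩
  -- The reverse factorisation is the forward one for the inverse element.
  obtain ⟨X, hX⟩ := key w⁻¹
  refine ⟨X, ?_⟩
  rw [Matrix.mul_assoc, ← hX, map_inv, ← Matrix.mul_assoc, Units.mul_inv, Matrix.one_mul]

theorem wreathHom_injective [∀ i, Nonempty (R i)] (A : ∀ i, Matrix (R i) (S i) MaxPlus) :
    Function.Injective (wreathHom n A) := by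
  rw [injective_iff_map_eq_one]
  intro w hw
  have h0 : (Matrix.blockDiagonal' fun i =>
      wreathMatrix (w i).right fun j => ((w i).left j).1.val) = Matrix.blockDiagonal' 1 :=
    (congrArg Units.val hw).trans blockDiagonal'_one.symm
  have h1 : ∀ i, wreathMatrix (w i).right (fun j => ((w i).left j).1.val) = 1 := fun i =>
    congrFun (blockDiagonal'_injective h0) i
  have h2 : ∀ i j a b, (if j = (w i).right j then ((w i).left j).1.val a b else 0) =
      (1 : Matrix (R i) (R i) MaxPlus) a b := fun i j a b => by
    refine (congrFun (congrFun (h1 i) (a, j)) (b, j)).trans ?_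
    simp [Matrix.one_apply]
  have h3 : ∀ i j, j = (w i).right j := fun i j => by
    by_contra hne
    have h4 := h2 i j (Classical.arbitrary _) (Classical.arbitrary _)
    rw [if_neg hne, Matrix.one_apply_eq] at h4
    exact zero_ne_one h4
  funext i
  refine SemidirectProduct.ext (funext fun j => Subtype.ext (Units.ext ?_))
    (Equiv.ext fun j => (h3 i j).symm)
  ext a b
  have h4 := h2 i j a b
  rwa [if_pos (h3 i j)] at h4

theorem exists_wreathHom_eq [∀ i, Nonempty (R i)] {A : ∀ i, Matrix (R i) (S i) MaxPlus}
    (hA : ∀ i, ColIrredundant (A i)) (hc : ∀ i, RowConnected (A i))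
    (hB : ColIrredundant (repeatDiag n A)) (hne : ∀ i i', Equivalent (A i) (A i') → i = i')
    {P : (Matrix (Σ i, R i × Fin (n i)) (Σ i, R i × Fin (n i)) MaxPlus)ˣ}
    (hP : P ∈ unitGroup (repeatDiag n A)) : ∃ w, wreathHom n A w = P := by
  obtain ⟨Q, hQ⟩ := hB.mem_unitGroup_iff.1 hP
  obtain ⟨π, hπ, hπ'⟩ := exists_block_perm hA hc hQ
  have hUU' : ∀ x, block (π x) x P.val * block x (π x) P⁻¹.val = 1 := fun x => by
    have h1 := block_mul_of_map (M := P.val) (fun x y hxy => (hπ' x y hxy).1) (z := π x) (π x)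
    rw [P.mul_inv, block_one_self, π.symm_apply_apply] at h1
    exact h1.symm
  have hU'U : ∀ x, block x (π x) P⁻¹.val * block (π x) x P.val = 1 := fun x => by
    have h1 := block_mul_of_map (M := P⁻¹.val) (fun x y hxy => (hπ x y hxy).1) (z := x) x
    rw [P.inv_mul, block_one_self] at h1
    exact h1.symm
  have hVV' : ∀ x, block (π x) x Q.val * block x (π x) Q⁻¹.val = 1 := fun x => by
    have h1 := block_mul_of_map (M := Q.val) (fun x y hxy => (hπ' x y hxy).2) (z := π x) (π x)
    rw [Q.mul_inv, block_one_self, π.symm_apply_apply] at h1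
    exact h1.symm
  have hV'V : ∀ x, block x (π x) Q⁻¹.val * block (π x) x Q.val = 1 := fun x => by
    have h1 := block_mul_of_map (M := Q⁻¹.val) (fun x y hxy => (hπ x y hxy).2) (z := x) x
    rw [Q.inv_mul, block_one_self] at h1
    exact h1.symm
  have hPQ : ∀ x y, block x y P.val * A y.1 = A x.1 * block x y Q.val := fun x y => by
    rw [← block_mul_repeatDiag, hQ, block_repeatDiag_mul]
  -- The nonzero blocks of `P` and `Q` are invertible and intertwine `A x.1` with `A (π x).1`.
  -- Inequivalence of distinct representatives then keeps `π` inside each class.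
  obtain ⟨s, hs⟩ := exists_sigma_perm (π := π) fun x => (hne _ _
    ⟨block (π x) x P.val, block x (π x) P⁻¹.val, block x (π x) Q⁻¹.val, block (π x) x Q.val,
      hUU' x, hU'U x, hV'V x, hVV' x, by
        rw [hPQ, Matrix.mul_assoc, hVV', Matrix.mul_one]⟩).symm
  have hs' : ∀ i j, π ⟨i, (s i).symm j⟩ = ⟨i, j⟩ := fun i j => by
    rw [hs, Equiv.apply_symm_apply]
  let F : ∀ i, Fin (n i) → (Matrix (R i) (R i) MaxPlus)ˣ := fun i j =>
    { val := block ⟨i, j⟩ ⟨i, (s i).symm j⟩ P.val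
      inv := block ⟨i, (s i).symm j⟩ ⟨i, j⟩ P⁻¹.val
      val_inv := by
        have h1 := hUU' ⟨i, (s i).symm j⟩
        rw [hs'] at h1
        exact h1
      inv_val := by
        have h1 := hU'U ⟨i, (s i).symm j⟩
        rw [hs'] at h1
        exact h1 }
  have hF : ∀ i j, F i j ∈ unitGroup (A i) := fun i j =>
    mem_unitGroup_iff.2 ⟨⟨_, hPQ ⟨i, j⟩ ⟨i, (s i).symm j⟩⟩,
      block ⟨i, (s i).symm j⟩ ⟨i, j⟩ Q⁻¹.val, by
        have h1 := hVV' ⟨i, (s i).symm j⟩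
        rw [hs'] at h1
        change A i = block ⟨i, j⟩ ⟨i, (s i).symm j⟩ P.val * A i * _
        exact (Matrix.mul_one (A i)).symm.trans ((congrArg (A i * ·) h1.symm).trans
          ((Matrix.mul_assoc _ _ _).symm.trans
            (congrArg (· * _) (hPQ ⟨i, j⟩ ⟨i, (s i).symm j⟩).symm)))⟩
  refine ⟨fun i => ⟨fun j => ⟨F i j, hF i j⟩, s i⟩, Units.ext ?_⟩
  rw [wreathHom_val]
  ext ⟨i, a, j⟩ ⟨i', a', j'⟩
  have h0 : (⟨i, j⟩ : Σ i, Fin (n i)) ≠ π ⟨i', j'⟩ → P.val ⟨i, (a, j)⟩ ⟨i', (a', j')⟩ = 0 :=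
    fun h => congrFun (congrFun (hπ _ _ h).1 a) a'
  rw [blockDiagonal'_apply]
  split_ifs with h1
  · change i = i' at h1
    subst h1
    rw [wreathMatrix_apply]
    split_ifs with h2
    · change j = s i j' at h2
      subst h2
      change P.val ⟨i, (a, s i j')⟩ ⟨i, (a', (s i).symm (s i j'))⟩ = _
      rw [Equiv.symm_apply_apply]
    · refine (h0 fun e => h2 ?_).symm
      rw [hs] at e
      exact eq_of_heq (Sigma.mk.inj_iff.1 e).2
  · refine (h0 fun e => h1 ?_).symm
    rw [hs] at e
    exact (Sigma.mk.inj_iff.1 e).1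

/-- The unit group of a block diagonal matrix with repeated, pairwise inequivalent, connected blocks
is a product of wreath products. -/
theorem unitGroup_repeatDiag_equiv [∀ i, Nonempty (R i)] {A : ∀ i, Matrix (R i) (S i) MaxPlus}
    (hA : ∀ i, ColIrredundant (A i)) (hc : ∀ i, RowConnected (A i))
    (hB : ColIrredundant (repeatDiag n A)) (hne : ∀ i i', Equivalent (A i) (A i') → i = i') :
    Nonempty (unitGroup (repeatDiag n A) ≃* ∀ i, SymmWreath (unitGroup (A i)) (n i)) := by
  refine ⟨((MonoidHom.ofInjective (wreathHom_injective A)).trans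
    (MulEquiv.subgroupCongr ?_)).symm⟩
  ext P
  exact ⟨fun ⟨w, hw⟩ => hw ▸ wreathHom_mem A w, fun hP => exists_wreathHom_eq hA hc hB hne hP⟩

/-- Isomorphic groups have isomorphic wreath products. -/
theorem symmWreath_congr {M N : Type} [Group M] [Group N] (e : M ≃* N) (k : ℕ) :
    Nonempty (SymmWreath M k ≃* SymmWreath N k) :=
  ⟨SemidirectProduct.congr (MulEquiv.piCongrRight fun _ => e) (MulEquiv.refl _) fun _ => rfl⟩

end RepeatDiag

/-! ### Decomposition into connected components -/

section Components

/-- A dependence among the columns of the submatrix extends by `-∞` to one of `A`, because the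
selected columns vanish outside the selected rows. -/
theorem ColIrredundant.submatrix_subtype {m n : Type} [Fintype n] {A : Matrix m n MaxPlus}
    (hA : ColIrredundant A) (p : m → Prop) (q : n → Prop) [Fintype {j // q j}]
    (h : ∀ i j, A i j ≠ 0 → (p i ↔ q j)) :
    ColIrredundant (A.submatrix (Subtype.val : {i // p i} → m) (Subtype.val : {j // q j} → n)) := by
  classical
  intro j x hx e
  refine hA j.1 (fun l => if hl : q l then x ⟨l, hl⟩ else 0) (by simp [j.2, hx])
    (funext fun i => ?_)
  change ∑ l, A i l * (if hl : q l then x ⟨l, hl⟩ else 0) = A i j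
  by_cases hi : p i
  · refine Eq.trans ?_ (congrFun e ⟨i, hi⟩)
    change _ = ∑ l : {j // q j}, A i l.1 * x l
    rw [← Finset.sum_filter_of_ne (p := q),
      Finset.sum_subtype (p := q) (Finset.univ.filter q) (by simp)]
    · refine Finset.sum_congr rfl fun l _ => ?_
      rw [dif_pos l.2]
    · intro l _ hl
      by_contra hq
      rw [dif_neg hq, mul_zero] at hl
      exact hl rfl
  · have h0 : ∀ l, q l → A i l = 0 := fun l hl => by
      by_contra h1
      exact hi ((h i l h1).2 hl)
    rw [h0 j.1 j.2]
    refine Finset.sum_eq_zero fun l _ => ?_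
    split_ifs with hl
    · rw [h0 l hl, zero_mul]
    · rw [mul_zero]

variable {r c : ℕ} {A : Matrix (Fin r) (Fin c) MaxPlus}

theorem bipartiteGraph_adj {i : Fin r} {j : Fin c} (h : A i j ≠ 0) :
    (bipartiteGraph A).Adj (Sum.inl i) (Sum.inr j) := by
  rw [bipartiteGraph, SimpleGraph.fromRel_adj]
  exact ⟨Sum.inl_ne_inr, Or.inl ⟨i, j, rfl, rfl, h⟩⟩

theorem component_eq {i : Fin r} {j : Fin c} (h : A i j ≠ 0) :
    (bipartiteGraph A).connectedComponentMk (Sum.inl i) =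
      (bipartiteGraph A).connectedComponentMk (Sum.inr j) :=
  SimpleGraph.ConnectedComponent.eq.2 (bipartiteGraph_adj h).reachable

theorem colIrredundant_restrict (hA : ColIrredundant A) (X : Component A) :
    ColIrredundant (restrict A X) :=
  hA.submatrix_subtype _ _ fun i j h => by rw [component_eq h]

theorem colIrredundant_restrict_transpose (hA : ColIrredundant Aᵀ) (X : Component A) :
    ColIrredundant (restrict A X)ᵀ :=
  hA.submatrix_subtype _ _ fun i j h => by rw [component_eq (A := A) h]

theorem nonempty_rowsOf (hA : ColIrredundant A) (X : Component A) : Nonempty (RowsOf A X) := by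
  obtain ⟨v, rfl⟩ := X.exists_rep
  rcases v with i | j
  · exact ⟨⟨i, rfl⟩⟩
  · obtain ⟨i, hi⟩ := hA.exists_ne_zero j
    exact ⟨⟨i, component_eq hi⟩⟩

theorem rowConnected_restrict (X : Component A) : RowConnected (restrict A X) := by
  classical
  intro α f g h i i'
  -- Extending by `none` off `X` gives a function on all vertices that is constant along edges, so
  -- walks need not be confined to `X`.
  let F : Fin r ⊕ Fin c → Option α := Sum.elim
    (fun i => if hi : (bipartiteGraph A).connectedComponentMk (Sum.inl i) = X
      then some (f ⟨i, hi⟩) else none)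
    (fun j => if hj : (bipartiteGraph A).connectedComponentMk (Sum.inr j) = X
      then some (g ⟨j, hj⟩) else none)
  have h1 : ∀ i j, A i j ≠ 0 → F (Sum.inl i) = F (Sum.inr j) := fun i j hij => by
    change dite _ _ _ = dite _ _ _
    by_cases hi : (bipartiteGraph A).connectedComponentMk (Sum.inl i) = X
    · have hj := (component_eq hij).symm.trans hi
      rw [dif_pos hi, dif_pos hj, h ⟨i, hi⟩ ⟨j, hj⟩ hij]
    · rw [dif_neg hi, dif_neg fun hj => hi ((component_eq hij).trans hj)]
  have h2 : ∀ u v, (bipartiteGraph A).Adj u v → F u = F v := fun u v huv => by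
    rw [bipartiteGraph, SimpleGraph.fromRel_adj] at huv
    obtain ⟨-, ⟨i, j, rfl, rfl, hij⟩ | ⟨i, j, rfl, rfl, hij⟩⟩ := huv
    · exact h1 i j hij
    · exact (h1 i j hij).symm
  obtain ⟨p⟩ := SimpleGraph.ConnectedComponent.eq.1 (i.2.trans i'.2.symm)
  have h3 : ∀ u v, (bipartiteGraph A).Walk u v → F u = F v := fun u v p => by
    induction p with
    | nil => rfl
    | cons hadj _ ih => exact (h2 _ _ hadj).trans ih
  have h4 := h3 _ _ p
  change dite _ _ _ = dite _ _ _ at h4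
  rw [dif_pos i.2, dif_pos i'.2] at h4
  exact Option.some_injective _ h4

/-- A matrix is, up to order, the block diagonal matrix of its restrictions to components. -/
theorem equivalent_blockDiagonal'_restrict {I : Type} [Fintype I] [DecidableEq I]
    (C : I ≃ Component A) :
    Equivalent A (Matrix.blockDiagonal' fun x => restrict A (C x)) := by
  let e : (Σ x, RowsOf A (C x)) ≃ Fin r :=
    (Equiv.sigmaCongrLeft (β := RowsOf A) C).trans (Equiv.sigmaFiberEquiv _)
  let f : (Σ x, ColsOf A (C x)) ≃ Fin c :=
    (Equiv.sigmaCongrLeft (β := ColsOf A) C).trans (Equiv.sigmaFiberEquiv _)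
  have : A.submatrix e f = Matrix.blockDiagonal' fun x => restrict A (C x) := by
    ext ⟨x, i⟩ ⟨y, j⟩
    rw [blockDiagonal'_apply]
    split_ifs with h
    · change x = y at h
      subst h
      rfl
    · change A i.1 j.1 = 0
      by_contra h0
      exact h (C.injective (i.2.symm.trans ((component_eq h0).trans j.2)))
  rw [← this]
  exact equivalent_submatrix A e f

end Components

theorem equivalent_repeatDiag {o : Type} [Fintype o] [DecidableEq o] {R S : o → Type}
    [∀ i, Fintype (R i)] [∀ i, DecidableEq (R i)] [∀ i, Fintype (S i)] [∀ i, DecidableEq (S i)]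
    (n : o → ℕ) (A : ∀ i, Matrix (R i) (S i) MaxPlus) :
    Equivalent (Matrix.blockDiagonal' fun x : Σ i, Fin (n i) => A x.1) (repeatDiag n A) := by
  let e : ∀ T : o → Type, (Σ i, T i × Fin (n i)) ≃ Σ x : (Σ i, Fin (n i)), T x.1 := fun T =>
    { toFun := fun y => ⟨⟨y.1, y.2.2⟩, y.2.1⟩
      invFun := fun y => ⟨y.1.1, (y.2, y.1.2)⟩
      left_inv := fun _ => rfl
      right_inv := fun _ => rfl }
  have : (Matrix.blockDiagonal' fun x : Σ i, Fin (n i) => A x.1).submatrix (e R) (e S) =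
      repeatDiag n A := by
    ext ⟨i, a, j⟩ ⟨i', b, j'⟩
    by_cases h : (⟨i, j⟩ : Σ i, Fin (n i)) = ⟨i', j'⟩
    · obtain ⟨rfl, h⟩ := Sigma.mk.inj_iff.1 h
      obtain rfl := eq_of_heq h
      refine (blockDiagonal'_apply_eq (fun x : Σ i, Fin (n i) => A x.1) ⟨i, j⟩ a b).trans ?_
      exact (congrFun (congrFun (block_repeatDiag_self A ⟨i, j⟩) a) b).symm
    · refine (blockDiagonal'_apply_ne (fun x : Σ i, Fin (n i) => A x.1) a b h).trans ?_
      exact (congrFun (congrFun (block_repeatDiag_of_ne A h) a) b).symm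
  rw [← this]
  exact equivalent_submatrix _ _ _

end TropicalMatrix

/-! ### Assembly of the main theorem -/

theorem mainTheorem5 (r c : ℕ) (A : Matrix (Fin r) (Fin c) MaxPlus) (hA : TropicalMatrix.FullRank A)
    (k : ℕ) (n : Fin k → ℕ) (hn : ∀ i, 0 < n i)
    (C : (Σ i : Fin k, Fin (n i)) ≃ TropicalMatrix.Component A)
    (hC : ∀ p q : Σ i : Fin k, Fin (n i),
      p.1 = q.1 ↔
        Nonempty (TropicalMatrix.colSpace (TropicalMatrix.restrict A (C p)) ≃ₗ[MaxPlus] TropicalMatrix.colSpace (TropicalMatrix.restrict A (C q)))) :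
    ∃ G : ∀ i : Fin k, Subgroup (Matrix (TropicalMatrix.RowsOf A (C ⟨i, ⟨0, hn i⟩⟩))
        (TropicalMatrix.RowsOf A (C ⟨i, ⟨0, hn i⟩⟩)) MaxPlus)ˣ,
      (∀ i, (G i : Set _) = TropicalMatrix.zeroEigenSet (TropicalMatrix.restrict A (C ⟨i, ⟨0, hn i⟩⟩))) ∧
      (∀ i, Finite (G i)) ∧
      (∀ i, ∃ f : G i →* Equiv.Perm (Fin (Fintype.card (TropicalMatrix.RowsOf A (C ⟨i, ⟨0, hn i⟩⟩)))),
        Function.Injective f) ∧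
      Nonempty (TropicalMatrix.unitGroup A ≃* ∀ i : Fin k, TropicalMatrix.SymmWreath (Multiplicative ℝ × G i) (n i)) := by
  have hcol := hA.colIrredundant
  have hrow := hA.colIrredundant_transpose
  have hiff : ∀ p q : Σ i : Fin k, Fin (n i), p.1 = q.1 ↔
      TropicalMatrix.Equivalent (TropicalMatrix.restrict A (C p))
        (TropicalMatrix.restrict A (C q)) := fun p q => by
    rw [hC]
    exact ⟨fun ⟨φ⟩ => TropicalMatrix.equivalent_of_colSpace_equiv
      (TropicalMatrix.colIrredundant_restrict hcol _)
      (TropicalMatrix.colIrredundant_restrict_transpose hrow _)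
      (TropicalMatrix.colIrredundant_restrict hcol _)
      (TropicalMatrix.colIrredundant_restrict_transpose hrow _) φ, fun h => h.colSpace⟩
  let B := fun i : Fin k => TropicalMatrix.restrict A (C ⟨i, ⟨0, hn i⟩⟩)
  have hB : ∀ i, TropicalMatrix.ColIrredundant (B i) := fun i =>
    TropicalMatrix.colIrredundant_restrict hcol _
  have hBc : ∀ i, TropicalMatrix.RowConnected (B i) := fun i =>
    TropicalMatrix.rowConnected_restrict _
  have : ∀ i, Nonempty (TropicalMatrix.RowsOf A (C ⟨i, ⟨0, hn i⟩⟩)) := fun i =>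
    TropicalMatrix.nonempty_rowsOf hcol _
  -- Split `A` into components, replace each by the representative of its class (index `0`), then
  -- regroup the equal blocks.
  have hAB : TropicalMatrix.Equivalent A (TropicalMatrix.repeatDiag n B) :=
    ((TropicalMatrix.equivalent_blockDiagonal'_restrict C).trans
      (TropicalMatrix.Equivalent.blockDiagonal' fun p =>
        (hiff p ⟨p.1, ⟨0, hn p.1⟩⟩).1 rfl)).trans (TropicalMatrix.equivalent_repeatDiag n B)
  obtain ⟨e₁⟩ := hAB.unitGroup
  obtain ⟨e₂⟩ := TropicalMatrix.unitGroup_repeatDiag_equiv hB hBc (hAB.colIrredundant hcol)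
    fun i i' h => (hiff ⟨i, ⟨0, hn i⟩⟩ ⟨i', ⟨0, hn i'⟩⟩).2 h
  have e₃ : ∀ i, Nonempty (TropicalMatrix.SymmWreath (TropicalMatrix.unitGroup (B i)) (n i) ≃*
      TropicalMatrix.SymmWreath (Multiplicative ℝ × TropicalMatrix.zeroMeanGroup (B i)) (n i)) :=
    fun i => (TropicalMatrix.unitGroup_equiv_prod (hB i)).elim fun e =>
      TropicalMatrix.symmWreath_congr e (n i)
  have hinj := fun i => TropicalMatrix.permHom_zeroMeanGroup_injective (hB i) (hBc i)
  refine ⟨fun i => TropicalMatrix.zeroMeanGroup (B i),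
    fun i => TropicalMatrix.coe_zeroMeanGroup (hB i) (hBc i),
    fun i => Finite.of_injective _ (hinj i), fun i => ?_,
    ⟨(e₁.trans e₂).trans (MulEquiv.piCongrRight fun i => (e₃ i).some)⟩⟩
  exact ⟨(Fintype.equivFin _).permCongrHom.toMonoidHom.comp
    (TropicalMatrix.permHom.comp (TropicalMatrix.zeroMeanGroup (B i)).subtype),
    (Fintype.equivFin (TropicalMatrix.RowsOf A _)).permCongrHom.injective.comp (hinj i)⟩
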